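/- Let $\kappa$ be a strongly inaccessible cardinal (uncountable, regular, strong limit), and let $H_\kappa$ be the collection of all sets of hereditary cardinality less than $\kappa$. **Trees.** A *$\kappa$-tree* is a poset $\mathbf T=(T,<_T)$ in which every set $x_\downarrow=\{y\in T\mid y<_T x\}$ is well-ordered by $<_T$, with order type denoted $\mathrm{ht}(x)$, such that for every $\alpha<\kappa$ the level $T_\alpha=\{x\in T\mid \mathrm{ht}(x)=\alpha\}$ is nonempty of size less than $\kappa$, and $T_\kappa=\emptyset$. An *$\alpha$-branch* is a chain $B\subseteq T$ with $\{\mathrm{ht}(x)\mid x\in B\}=\alpha$; a chain is *vanishing* if it has no upper bound in $T$. The tree is *full* if for every limit ordinal $\alpha<\kappa$ there is at most one vanishing $\alpha$-branch; *normal* if for all $\bar\alpha<\alpha<\kappa$ and $x\in T_{\bar\alpha}$ there is $y\in T_\alpha$ with $x<_Ty$; *splitting* if every node has at least two immediate successors; *$\kappa$-Souslin* if it is a $\kappa$-tree with no $\kappa$-branch and no antichain of size $\kappa$. The *product* $\bigotimes_{i\in I}\mathbf T^i$ of a nonempty family of $\kappa$-trees has underlying set $\bigcup_{\alpha<\kappa}\prod_{i\in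 I}(T^i)_\alpha$, ordered by $\vec s<\vec t$ iff $\vec s(i)<_{T^i}\vec t(i)$ for all $i\in I$. A *streamlined $\kappa$-tree* is a set $T\subseteq{}^{<\kappa}H_\kappa$ such that $t\restriction\alpha\in T$ for all $t\in T$ and $\alpha<\kappa$, and such that $T_\alpha=T\cap{}^\alpha H_\kappa$ is nonempty of size less than $\kappa$ for every $\alpha<\kappa$; it is identified with the $\kappa$-tree $(T,\subset)$. It is *binary* if $T\subseteq{}^{<\kappa}2$. **Principles.** Let $E^\kappa_{>\omega}=\{\alpha<\kappa\mid \mathrm{cf}(\alpha)>\omega\}$. For a stationary $S\subseteq E^\kappa_{>\omega}$, $\diamondsuit^*_S(\kappa\text{-trees})$ asserts that there is a sequence $\langle f_\beta\mid\beta<\kappa\rangle$ such that for every streamlined $\kappa$-tree $T$ there is a club $D\subseteq\kappa$ such that for all $\alpha\in S\cap D$ and $f\in T_\alpha$, the set $\{\beta<\alpha\mid f\restriction\beta=f_\beta\}$ is stationary in $\alpha$. For a set $C$ of ordinals let $\mathrm{acc}(C)=\{\alpha\in C\mid \sup(C\cap\alpha)=\alpha>0\}$ and $\mathrm{nacc}(C)=C\setminus\mathrm{acc}(C)$.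 The principle $\mathrm P^-(\kappa,2,\sqsubseteq,1,\{S\})$ asserts that there is a sequence $\langle C_\alpha\mid\alpha<\kappa\rangle$ such that each $C_\alpha$ is a closed subset of $\alpha$ with $\sup(C_\alpha)=\sup(\alpha)$; for all $\alpha<\kappa$ and $\beta\in\mathrm{acc}(C_\alpha)$, $C_\beta$ is an initial segment of $C_\alpha$, i.e. $C_\beta=C_\alpha\cap\gamma$ for some ordinal $\gamma$; and for every cofinal $B\subseteq\kappa$, there are stationarily many $\alpha\in S$ with $\sup(\mathrm{nacc}(C_\alpha)\cap B)=\alpha$. **Theorem.** Suppose that $\kappa$ is strongly inaccessible, $S\subseteq E^\kappa_{>\omega}$ is stationary in $\kappa$, and both $\diamondsuit^*_S(\kappa\text{-trees})$ and $\mathrm P^-(\kappa,2,\sqsubseteq,1,\{S\})$ hold. Then there is a family $\mathcal T$ of exactly $2^\kappa$ many streamlined, normal, binary, splitting, full $\kappa$-trees such that $\bigotimes\mathcal T'$ is a $\kappa$-Souslin tree for every nonempty $\mathcal T'\subseteq\mathcal T$ with $|\mathcal T'|<\kappa$. -/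

import Mathlib

open Set Cardinal Ordinal

universe u v w

/-! ### Sets of ordinals -/

/-- `D ∩ δ` is closed and unbounded in the ordinal `δ`. -/
def ClubIn (δ : Ordinal.{u}) (D : Set Ordinal.{u}) : Prop :=
  IsClub (Subtype.val ⁻¹' D : Set (Iio δ))

/-- `S ∩ δ` meets every closed unbounded subset of the ordinal `δ`. -/
def StationaryIn (δ : Ordinal.{u}) (S : Set Ordinal.{u}) : Prop :=
  IsStationary (Subtype.val ⁻¹' S : Set (Iio δ))

/-- The set of ordinals `α < κ` of uncountable cofinality. -/
def uncountableCofBelow (κ : Cardinal.{u}) : Set Ordinal.{u} :=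
  {α | α < κ.ord ∧ ℵ₀ < α.cof}

/-- `acc(C) = {α ∈ C | sup (C ∩ α) = α > 0}`. -/
def accPts (C : Set Ordinal.{u}) : Set Ordinal.{u} :=
  {α | α ∈ C ∧ sSup (C ∩ Iio α) = α ∧ 0 < α}

/-- `nacc(C) = C \ acc(C)`. -/
def naccPts (C : Set Ordinal.{u}) : Set Ordinal.{u} := C \ accPts C

/-- `D ⊑ C`: `D` is an initial segment `C ∩ β` of `C`. -/
def InitSegOf (D C : Set Ordinal.{u}) : Prop := ∃ β : Ordinal.{u}, D = C ∩ Iio β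

/-- `⟨C α | α < κ⟩` is a `C`-sequence over `κ`: each `C α` is a closed subset of `α` with
`sup (C α) = sup α` (where `sup ∅ = 0`). -/
def IsCSequence (κ : Cardinal.{u}) (C : Ordinal.{u} → Set Ordinal.{u}) : Prop :=
  ∀ α < κ.ord, C α ⊆ Iio α ∧
    (∀ β < α, 0 < β → sSup (C α ∩ Iio β) = β → β ∈ C α) ∧
    sSup (C α) = sSup (Iio α)

/-- `R`-coherence of a `C`-sequence over `κ`. -/
def IsCoherentSeq (κ : Cardinal.{u}) (R : Set Ordinal.{u} → Set Ordinal.{u} → Prop)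
    (C : Ordinal.{u} → Set Ordinal.{u}) : Prop :=
  ∀ α < κ.ord, ∀ β < α, β ∈ accPts (C α) → R (C β) (C α)

/-- The proxy principle `P⁻(κ, 2, R, θ, 𝒮)`. -/
def ProxyMinusTwo (κ : Cardinal.{u}) (R : Set Ordinal.{u} → Set Ordinal.{u} → Prop)
    (θ : Cardinal.{u}) (𝒮 : Set (Set Ordinal.{u})) : Prop :=
  ∃ C : Ordinal.{u} → Set Ordinal.{u}, IsCSequence κ C ∧ IsCoherentSeq κ R C ∧
    ∀ B : Ordinal.{u} → Set Ordinal.{u},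
      (∀ i < θ.ord, B i ⊆ Iio κ.ord ∧ ∀ γ < κ.ord, ∃ β ∈ B i, γ ≤ β) →
      ∀ S ∈ 𝒮, StationaryIn κ.ord
        {α | α ∈ S ∧ ∀ i < min α θ.ord, sSup (naccPts (C α) ∩ B i) = α}

/-! ### Abstract trees -/

section Trees

variable (T : Type v) [PartialOrder T]

/-- The `α`-th level of `T`: the nodes whose set of predecessors has order type `α`. -/
def treeLevel (α : Ordinal.{u}) : Set T := {x | Nonempty (Iio x ≃o Iio α)}

/-- The poset `T` is a `κ`-tree. -/
structure IsKappaTree (κ : Cardinal.{u}) : Prop where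
  wellOrdered : ∀ x : T, IsWellOrder (Iio x) (· < ·)
  nonempty : ∀ α < κ.ord, (treeLevel T α).Nonempty
  small : ∀ α < κ.ord, Cardinal.lift.{u} #(treeLevel T α) < Cardinal.lift.{v} κ
  top_empty : treeLevel T κ.ord = ∅

variable {T} in
/-- `B` is an `α`-branch: a chain whose set of heights is exactly `α`. -/
def IsBranchOf (α : Ordinal.{u}) (B : Set T) : Prop :=
  IsChain (· ≤ ·) B ∧ (∀ x ∈ B, ∃ β < α, x ∈ treeLevel T β) ∧
    ∀ β < α, ∃ x ∈ B, x ∈ treeLevel T β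

variable {T} in
/-- `X` has no upper bound in the tree. -/
def IsVanishing (X : Set T) : Prop := ¬ ∃ y : T, ∀ x ∈ X, x ≤ y

/-- For every limit `α < κ` there is at most one vanishing `α`-branch. -/
def IsFullTree (κ : Cardinal.{u}) : Prop :=
  ∀ α < κ.ord, Order.IsSuccLimit α → ∀ B B' : Set T,
    IsBranchOf α B → IsVanishing B → IsBranchOf α B' → IsVanishing B' → B = B'

/-- Every node has extensions on all higher levels below `κ`. -/
def IsNormalTree (κ : Cardinal.{u}) : Prop :=
  ∀ α < κ.ord, ∀ β < α, ∀ x ∈ treeLevel T β, ∃ y ∈ treeLevel T α, x < y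

/-- Every node has at least two immediate successors. -/
def IsSplittingTree : Prop := ∀ x : T, ∃ y z : T, y ≠ z ∧ x ⋖ y ∧ x ⋖ z

/-- `T` is a `κ`-tree with neither `κ`-branches nor antichains of size `κ`. -/
def IsSouslinTree (κ : Cardinal.{u}) : Prop :=
  IsKappaTree T κ ∧ (∀ B : Set T, ¬ IsBranchOf κ.ord B) ∧
    ∀ A : Set T, IsAntichain (· ≤ ·) A → Cardinal.lift.{u} #A ≠ Cardinal.lift.{v} κ

end Trees

section Product

variable {ι : Type w}

/-- The underlying set `⋃_{α < κ} ∏_i (T i)_α` of the product of a family of `κ`-trees. -/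
def ProductTree (κ : Cardinal.{u}) (T : ι → Type v) [∀ i, PartialOrder (T i)] : Type (max v w) :=
  {s : ∀ i, T i // ∃ α < κ.ord, ∀ i, s i ∈ treeLevel (T i) α}

/-- The product of a nonempty family of trees is ordered by `s < t` iff `s i < t i` for all `i`. -/
instance ProductTree.instPartialOrder [Nonempty ι] (κ : Cardinal.{u}) (T : ι → Type v)
    [∀ i, PartialOrder (T i)] : PartialOrder (ProductTree κ T) where
  le s t := s = t ∨ ∀ i, s.1 i < t.1 i
  lt s t := ∀ i, s.1 i < t.1 i
  le_refl s := Or.inl rfl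
  le_trans s t r := by
    rintro (rfl | h) (rfl | h')
    · exact Or.inl rfl
    · exact Or.inr h'
    · exact Or.inr h
    · exact Or.inr fun i => (h i).trans (h' i)
  le_antisymm s t := by
    rintro (rfl | h) (h' | h')
    · rfl
    · rfl
    · exact h'.symm
    · obtain ⟨i⟩ := ‹Nonempty ι›
      exact absurd ((h i).trans (h' i)) (lt_irrefl _)
  lt_iff_le_not_ge s t := by
    obtain ⟨i⟩ := ‹Nonempty ι›
    constructor
    · intro h
      refine ⟨Or.inr h, ?_⟩
      rintro (rfl | h')
      · exact lt_irrefl _ (h i)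
      · exact lt_irrefl _ ((h i).trans (h' i))
    · rintro ⟨rfl | h, h'⟩
      · exact absurd (Or.inl rfl) h'
      · exact h

end Product

/-! ### Streamlined trees -/

/-- `H_κ`, the sets of hereditary cardinality less than `κ` (for regular `κ` this is the same as
having a transitive closure of size less than `κ`). -/
def HSet (κ : Cardinal.{u}) : Set ZFSet.{u} := {x | ZFSet.Hereditarily (fun y => y.card < κ) x}

/-- A transfinite sequence of sets, indexed by the ordinals below `len`. -/
structure OrdSeq : Type (u + 1) where
  len : Ordinal.{u}
  val : Iio len → ZFSet.{u}

namespace OrdSeq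

/-- Sequences are ordered by end-extension, that is, by inclusion of their graphs. -/
instance : PartialOrder OrdSeq.{u} where
  le s t := ∃ h : s.len ≤ t.len,
    ∀ (i : Ordinal.{u}) (hi : i < s.len), s.val ⟨i, hi⟩ = t.val ⟨i, hi.trans_le h⟩
  le_refl s := ⟨le_rfl, fun _ _ => rfl⟩
  le_trans s t r := by
    rintro ⟨h, e⟩ ⟨h', e'⟩
    exact ⟨h.trans h', fun i hi => (e i hi).trans (e' i _)⟩
  le_antisymm := by
    rintro ⟨a, f⟩ ⟨b, g⟩ ⟨h, e⟩ ⟨h', _⟩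
    obtain rfl : a = b := le_antisymm h h'
    congr 1
    funext i
    exact e i.1 i.2

/-- The restriction `t ↾ β` of a sequence to the indices below `β`. -/
noncomputable def restrict (t : OrdSeq.{u}) (β : Ordinal.{u}) : OrdSeq.{u} where
  len := min t.len β
  val i := t.val ⟨i.1, (mem_Iio.1 i.2).trans_le (min_le_left _ _)⟩

end OrdSeq

/-- `T ⊆ ^{<κ}H_κ` is a streamlined `κ`-tree; it is identified with the poset of its members
ordered by inclusion. -/
structure IsStreamlined (κ : Cardinal.{u}) (T : Set OrdSeq.{u}) : Prop where
  len_lt : ∀ t ∈ T, t.len < κ.ord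
  val_mem : ∀ t ∈ T, ∀ i, t.val i ∈ HSet κ
  restrict_mem : ∀ t ∈ T, ∀ α < κ.ord, t.restrict α ∈ T
  nonempty : ∀ α < κ.ord, ∃ t ∈ T, t.len = α
  small : ∀ α < κ.ord, #{t : OrdSeq.{u} | t ∈ T ∧ t.len = α} < Cardinal.lift.{u + 1} κ

/-- All entries of the sequences in `T` belong to `2 = {∅, {∅}}`. -/
def IsBinary (T : Set OrdSeq.{u}) : Prop :=
  ∀ t ∈ T, ∀ i, t.val i = ∅ ∨ t.val i = {∅}

/-- The principle `◊*_{S,B}(κ-trees)`. -/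
def DiamondStarTrees (κ : Cardinal.{u}) (S B : Set Ordinal.{u}) : Prop :=
  ∃ f : Ordinal.{u} → OrdSeq.{u}, ∀ T : Set OrdSeq.{u}, IsStreamlined κ T →
    ∃ D : Set Ordinal.{u}, ClubIn κ.ord D ∧
      ∀ α ∈ S ∩ D, ∀ t ∈ T, t.len = α →
        StationaryIn α {β | β ∈ B ∧ β < α ∧ t.restrict β = f β}

/-! A node of height `γ` is a set of ordinals of which only the part below `γ` matters, and each `H
⊆ κ` indexes one tree. All trees come from a single recursion, in which `◊*` supplies guesses and
the `C`-sequence supplies instructions. At a limit `γ`, a branch of the tree with index `H` is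
omitted only if the guess at `γ` attaches exactly this branch to `H` and the branch does not follow
the instructions along a final segment of `C γ`. So at most one branch is omitted (`Killed.unique`),
which gives fullness. A branch that follows the instructions survives, and by coherence this
persists at the limit points of `C α`, which gives normality (`exists_lev_extension`).

The instruction at `γ` along `c` looks back to the supremum `β` of the earlier points of `c` whose
guesses are compatible with that at `γ`. If the tuple guessed at `β` has an extension that has
followed the instructions since `β` and meets the guessed target below `γ`, one such extension is
fixed and every coordinate is told to enter it.

The core is sealing (`exists_forall_levTuple_target`): if every tuple of nodes, from fewer than `κ`
trees with different indices, extends into a target `U`, then on some level all tuples have met `U`.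
Otherwise the proxy principle yields `α ∈ S` such that `C α` has cofinally many non-accumulation
points with correct guesses about `U`; let `τ` be a tuple of height `α` missing `U`. Each coordinate
of `τ` eventually follows the instructions along `C α`, for otherwise `◊*` guesses it at a limit `β`
of failures and it is omitted there. Since `α` is regular (`ord_cof_eq_of_guesses`), one bound
serves all coordinates. Guess `τ` once more at a limit `β` of correct points above that bound: at
the next correct point `γ` the instruction forces `τ` into `U`, a contradiction.

Sealing the complement of a branch, or the nodes that decide an antichain, makes the products
Souslin. Sealing the pairs of distinct nodes shows that different indices give different trees. -/

/-! ### Clubs of ordinals -/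

/-- `β` is a limit of elements of `A`. -/
def IsLimPt (A : Set Ordinal.{u}) (β : Ordinal.{u}) : Prop :=
  0 < β ∧ ∀ ξ < β, ∃ ζ ∈ A, ξ < ζ ∧ ζ < β

theorem IsLimPt.mono {A B : Set Ordinal.{u}} (h : A ⊆ B) {β : Ordinal.{u}} (hβ : IsLimPt A β) :
    IsLimPt B β :=
  ⟨hβ.1, fun ξ hξ => let ⟨ζ, h1, h2⟩ := hβ.2 ξ hξ; ⟨ζ, h h1, h2⟩⟩

theorem IsLimPt.isSuccLimit {A : Set Ordinal.{u}} {β : Ordinal.{u}} (hβ : IsLimPt A β) :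
    Order.IsSuccLimit β := by
  rw [Ordinal.isSuccLimit_iff, Order.isSuccPrelimit_iff_succ_lt]
  refine ⟨hβ.1.ne', fun ξ hξ => ?_⟩
  obtain ⟨ζ, -, h1, h2⟩ := hβ.2 ξ hξ
  exact (Order.succ_le_of_lt h1).trans_lt h2

theorem bddAbove_inter_Iio (C : Set Ordinal.{u}) (β : Ordinal.{u}) : BddAbove (C ∩ Iio β) :=
  ⟨β, fun _ h => (mem_Iio.1 h.2).le⟩

theorem sSup_inter_Iio_le (C : Set Ordinal.{u}) (β : Ordinal.{u}) : sSup (C ∩ Iio β) ≤ β :=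
  csSup_le' fun _ h => (mem_Iio.1 h.2).le

theorem isLimPt_iff (C : Set Ordinal.{u}) (β : Ordinal.{u}) :
    IsLimPt C β ↔ sSup (C ∩ Iio β) = β ∧ 0 < β := by
  constructor
  · refine fun h => ⟨le_antisymm (sSup_inter_Iio_le C β) (le_of_forall_lt fun ξ hξ => ?_), h.1⟩
    obtain ⟨ζ, h1, h2, h3⟩ := h.2 ξ hξ
    exact h2.trans_le (le_csSup (bddAbove_inter_Iio C β) ⟨h1, h3⟩)
  · rintro ⟨h, h0⟩
    refine ⟨h0, fun ξ hξ => ?_⟩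
    by_contra! hc
    have : sSup (C ∩ Iio β) ≤ ξ := csSup_le' fun ζ hζ => by
      by_contra! h'
      exact (hc ζ hζ.1 h').not_gt hζ.2
    exact (h ▸ this).not_gt hξ

theorem mem_accPts_iff {C : Set Ordinal.{u}} {α : Ordinal.{u}} :
    α ∈ accPts C ↔ α ∈ C ∧ IsLimPt C α := by
  rw [isLimPt_iff]; rfl

theorem mem_naccPts_iff {C : Set Ordinal.{u}} {α : Ordinal.{u}} :
    α ∈ naccPts C ↔ α ∈ C ∧ ¬ IsLimPt C α := by
  rw [naccPts, mem_sdiff, mem_accPts_iff]; tauto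

theorem clubIn_of {δ : Ordinal.{u}} {D : Set Ordinal.{u}}
    (closed : ∀ β < δ, IsLimPt D β → β ∈ D) (unb : ∀ ξ < δ, ∃ ζ ∈ D, ξ ≤ ζ ∧ ζ < δ) :
    ClubIn δ D := by
  refine ⟨fun s hs hne _ a ha => ?_, fun x => ?_⟩
  -- A least upper bound that is not attained is a limit point of the set, hence of `D`.
  · by_cases has : a ∈ s
    · exact hs has
    · refine closed a.1 a.2 ⟨?_, fun ξ hξ => ?_⟩
      · obtain ⟨x, hx⟩ := hne
        have h1 : x ≤ a := ha.1 hx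
        have h2 : x ≠ a := by rintro rfl; exact has hx
        exact (zero_le).trans_lt (lt_of_le_of_ne h1 h2 : x < a)
      · by_contra! hc
        have : a ≤ ⟨ξ, hξ.trans a.2⟩ := ha.2 fun x hx => by
          by_contra! h'
          have h1 : x ≤ a := ha.1 hx
          have h2 := hc x.1 (hs hx) h'
          exact has ((le_antisymm h1 h2) ▸ hx)
        exact (show a.1 ≤ ξ from this).not_gt hξ
  · obtain ⟨ζ, h1, h2, h3⟩ := unb x.1 x.2
    exact ⟨⟨ζ, h3⟩, h1, h2⟩

theorem ClubIn.exists_gt {δ : Ordinal.{u}} {D : Set Ordinal.{u}} (h : ClubIn δ D)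
    (hδ : Order.IsSuccLimit δ) {ξ : Ordinal.{u}} (hξ : ξ < δ) : ∃ ζ ∈ D, ξ < ζ ∧ ζ < δ := by
  obtain ⟨ζ, h1, h2⟩ := h.isCofinal ⟨Order.succ ξ, hδ.succ_lt hξ⟩
  exact ⟨ζ.1, h1, (Order.lt_succ ξ).trans_le h2, ζ.2⟩

theorem StationaryIn.exists_mem {δ : Ordinal.{u}} {S D : Set Ordinal.{u}} (h : StationaryIn δ S)
    (hD : ClubIn δ D) : ∃ α ∈ S, α ∈ D ∧ α < δ := by
  obtain ⟨x, h1, h2⟩ := h hD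
  exact ⟨x.1, h1, h2, x.2⟩

theorem isSuccLimit_of_aleph0_lt_cof {δ : Ordinal.{u}} (hδ : ℵ₀ < δ.cof) : Order.IsSuccLimit δ :=
  Ordinal.one_lt_cof_iff.1 (Cardinal.one_lt_aleph0.trans hδ)

theorem ClubIn.inter {δ : Ordinal.{u}} (hδ : ℵ₀ < δ.cof) {D E : Set Ordinal.{u}}
    (hD : ClubIn δ D) (hE : ClubIn δ E) : ClubIn δ (D ∩ E) := by
  refine IsClub.inter ?_ hD hE
  rw [Ordinal.cof_Iio, ← Ordinal.lift_cof]
  intro h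
  rw [Cardinal.lift_eq_aleph0] at h
  exact hδ.ne' h

theorem clubIn_Ioi {δ : Ordinal.{u}} (hδ : ℵ₀ < δ.cof) {ξ : Ordinal.{u}} (hξ : ξ < δ) :
    ClubIn δ (Ioi ξ) := by
  refine clubIn_of (fun β _ hl => ?_) fun η hη => ?_
  · obtain ⟨ζ, h1, -, h2⟩ := hl.2 0 hl.1
    exact (mem_Ioi.1 h1).trans h2
  · exact ⟨Order.succ (max ξ η), (le_max_left ξ η).trans_lt (Order.lt_succ _),
      (le_max_right ξ η).trans (Order.le_succ _),
      (isSuccLimit_of_aleph0_lt_cof hδ).succ_lt (max_lt hξ hη)⟩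

/-- The witness is the supremum of the iterates of `f` from `ξ`. As `f` need not be monotone,
closure is claimed only at cofinally many `x`, namely at the iterates. -/
theorem exists_closed_under {δ : Ordinal.{u}} (hδ : ℵ₀ < δ.cof) {f : Ordinal.{u} → Ordinal.{u}}
    (hf : ∀ ξ < δ, ξ < f ξ ∧ f ξ < δ) {ξ : Ordinal.{u}} (hξ : ξ < δ) :
    ∃ β < δ, ξ < β ∧ ∀ η < β, ∃ x, η < x ∧ x < β ∧ f x < β := by
  have hlt : ∀ n, f^[n] ξ < δ := fun n => by
    induction n with
    | zero => exact hξ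
    | succ n ih => rw [Function.iterate_succ_apply']; exact (hf _ ih).2
  have hs : ∀ n, f^[n] ξ < f^[n + 1] ξ := fun n => by
    rw [Function.iterate_succ_apply']; exact (hf _ (hlt n)).1
  have hn : ∀ n, f^[n] ξ < nfp f ξ := fun n => (hs n).trans_le (iterate_le_nfp f ξ _)
  refine ⟨nfp f ξ, nfp_lt_ord hδ (fun i hi => (hf i hi).2) hξ, hn 0, fun η hη => ?_⟩
  obtain ⟨n, h⟩ := lt_nfp_iff.1 hη
  refine ⟨f^[n] ξ, h, hn n, ?_⟩
  rw [← Function.iterate_succ_apply' f n ξ]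
  exact hn _

theorem clubIn_isLimPt {δ : Ordinal.{u}} (hδ : ℵ₀ < δ.cof) {A : Set Ordinal.{u}}
    (hA : ∀ ξ < δ, ∃ ζ ∈ A, ξ < ζ ∧ ζ < δ) : ClubIn δ {β | IsLimPt A β} := by
  refine clubIn_of (fun β _ hl => ⟨hl.1, fun ξ hξ => ?_⟩) fun ξ hξ => ?_
  · obtain ⟨ζ, h1, h2, h3⟩ := hl.2 ξ hξ
    obtain ⟨η, h4, h5, h6⟩ := h1.2 ξ h2
    exact ⟨η, h4, h5, h6.trans h3⟩
  · choose! f hf using hA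
    obtain ⟨β, h1, h2, h3⟩ := exists_closed_under hδ (fun ξ hξ => (hf ξ hξ).2) hξ
    refine ⟨β, ⟨(zero_le).trans_lt h2, fun η hη => ?_⟩, h2.le, h1⟩
    obtain ⟨x, h4, h5, h6⟩ := h3 η hη
    exact ⟨f x, (hf x (h5.trans h1)).1, h4.trans (hf x (h5.trans h1)).2.1, h6⟩

/-- The closure points of a `κ`-bounded monotone relation form a club. -/
theorem clubIn_closure {δ : Ordinal.{u}} (hδ : ℵ₀ < δ.cof) {P : Ordinal.{u} → Ordinal.{u} → Prop}
    (hP : ∀ ξ < δ, ∃ ζ < δ, ∀ η ≤ ξ, ∃ ζ' ≤ ζ, P η ζ') :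
    ClubIn δ {β | ∀ η < β, ∃ ζ < β, P η ζ} := by
  refine clubIn_of (fun β _ hl η hη => ?_) fun ξ hξ => ?_
  · obtain ⟨d, h1, h2, h3⟩ := hl.2 η hη
    obtain ⟨ζ, h4, h5⟩ := h1 η h2
    exact ⟨ζ, h4.trans h3, h5⟩
  · choose! f hf hfP using hP
    have hlim := isSuccLimit_of_aleph0_lt_cof hδ
    obtain ⟨β, h1, h2, h3⟩ := exists_closed_under hδ (f := fun x => max (Order.succ x) (f x))
      (fun x hx => ⟨(Order.lt_succ x).trans_le (le_max_left _ _),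
        max_lt (hlim.succ_lt hx) (hf x hx)⟩) hξ
    refine ⟨β, fun η hη => ?_, h2.le, h1⟩
    obtain ⟨x, h4, h5, h6⟩ := h3 η hη
    obtain ⟨ζ, h7, h8⟩ := hfP x (h5.trans h1) η h4.le
    exact ⟨ζ, h7.trans_lt ((le_max_right _ _).trans_lt h6), h8⟩

/-! ### Families bounded below a cofinality -/

theorem exists_lt_forall_le {α : Ordinal.{u}} {X : Type (u + 1)}
    (hX : #X < Cardinal.lift.{u + 1} α.cof) (f : X → Ordinal.{u}) (hf : ∀ x, f x < α) :
    ∃ β < α, ∀ x, f x ≤ β := by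
  have hr : #(range f) < (Ordinal.lift.{u + 1} α).cof := by
    rw [← Ordinal.lift_cof]
    exact mk_range_le.trans_lt hX
  refine ⟨sSup (range f), sSup_lt_of_lt_cof hr (by rintro _ ⟨x, rfl⟩; exact hf x), fun x => ?_⟩
  exact le_csSup ⟨α, by rintro _ ⟨y, rfl⟩; exact (hf y).le⟩ ⟨x, rfl⟩

theorem mk_Iio_lt_of_lt_ord {c : Cardinal.{u}} {θ : Ordinal.{u}} (h : θ < c.ord) :
    #(Iio θ) < Cardinal.lift.{u + 1} c := by
  rw [Cardinal.mk_Iio_ordinal, Cardinal.lift_lt]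
  exact Cardinal.lt_ord.1 h

/-! ### Agreement of sets of ordinals below an ordinal -/

/-- `X` and `Y` have the same elements below `β`. -/
def AgreeBelow (β : Ordinal.{u}) (X Y : Set Ordinal.{u}) : Prop := ∀ ξ < β, ξ ∈ X ↔ ξ ∈ Y

namespace AgreeBelow

variable {β γ : Ordinal.{u}} {X Y Z : Set Ordinal.{u}}

theorem refl (β : Ordinal.{u}) (X : Set Ordinal.{u}) : AgreeBelow β X X := fun _ _ => Iff.rfl

theorem symm (h : AgreeBelow β X Y) : AgreeBelow β Y X := fun ξ hξ => (h ξ hξ).symm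

theorem trans (h : AgreeBelow β X Y) (h' : AgreeBelow β Y Z) : AgreeBelow β X Z :=
  fun ξ hξ => (h ξ hξ).trans (h' ξ hξ)

theorem mono (h : AgreeBelow β X Y) (hγ : γ ≤ β) : AgreeBelow γ X Y :=
  fun ξ hξ => h ξ (hξ.trans_le hγ)

theorem inter_eq (h : AgreeBelow β X Y) : X ∩ Iio β = Y ∩ Iio β := by
  ext ξ
  exact and_congr_left fun hξ => h ξ hξ

theorem inter_Iio (X : Set Ordinal.{u}) (h : γ ≤ β) : AgreeBelow γ (X ∩ Iio β) X :=
  fun _ hξ => and_iff_left (hξ.trans_le h)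

theorem of_inter_eq (h : X ∩ Iio β = Y ∩ Iio β) : AgreeBelow β X Y :=
  fun ξ hξ => by simpa [hξ] using Set.ext_iff.1 h ξ

end AgreeBelow

/-- Being a limit point at `ξ` depends on `c` below `ξ` only. This makes the instructions local, so
that they can be moved between `C α` and `C β` by coherence. -/
theorem naccPts_inter_Iio (c : Set Ordinal.{u}) (γ : Ordinal.{u}) :
    naccPts (c ∩ Iio γ) = naccPts c ∩ Iio γ := by
  ext ξ
  simp only [mem_naccPts_iff, mem_inter_iff, mem_Iio]
  constructor
  · rintro ⟨⟨h1, h2⟩, h3⟩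
    refine ⟨⟨h1, fun hl => h3 ⟨hl.1, fun η hη => ?_⟩⟩, h2⟩
    obtain ⟨ζ, h4, h5, h6⟩ := hl.2 η hη
    exact ⟨ζ, ⟨h4, h6.trans h2⟩, h5, h6⟩
  · rintro ⟨⟨h1, h2⟩, h3⟩
    exact ⟨⟨h1, h3⟩, fun hl => h2 (hl.mono inter_subset_left)⟩

/-! ### Guesses -/

/-- The part of a guess at one coordinate which does not depend on the guessed tuple of nodes: the
number of trees, the column of the tree indices, a level of a set of tuples, and a flag. -/
@[ext]
structure SideDatum : Type (u + 1) where
  len : Ordinal.{u}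
  idx : Set Ordinal.{u}
  target : Set (Ordinal.{u} → Set Ordinal.{u})
  flag : Prop

/-- What is guessed at one coordinate: a column of the tuple of nodes, and side information. -/
@[ext]
structure GuessDatum : Type (u + 1) where
  col : Set Ordinal.{u}
  side : SideDatum.{u}

/-- A sequence of guesses: the guess at `β` consists of its coordinates below `β`. -/
abbrev GuessSeq := Ordinal.{u} → Ordinal.{u} → GuessDatum.{u}

/-- The guess at `β` for the length of the tuple. -/
def guessLen (g : GuessSeq.{u}) (β : Ordinal.{u}) : Ordinal.{u} := (g β 0).side.len

/-- The guess at `β` for the index of the `i`th tree. -/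
def guessIdx (g : GuessSeq.{u}) (β i : Ordinal.{u}) : Set Ordinal.{u} := {ξ | i ∈ (g β ξ).side.idx}

/-- The guess at `β` for the `i`th node. -/
def guessTuple (g : GuessSeq.{u}) (β i : Ordinal.{u}) : Set Ordinal.{u} := {ξ | i ∈ (g β ξ).col}

/-- The restriction of a tuple to length `θ` and height `ζ`. -/
def normTuple (θ ζ : Ordinal.{u}) (s : Ordinal.{u} → Set Ordinal.{u}) :
    Ordinal.{u} → Set Ordinal.{u} := fun i => {ξ | i < θ ∧ ξ < ζ ∧ ξ ∈ s i}

theorem normTuple_congr {θ ζ : Ordinal.{u}} {s t : Ordinal.{u} → Set Ordinal.{u}}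
    (h : ∀ i < θ, AgreeBelow ζ (s i) (t i)) : normTuple θ ζ s = normTuple θ ζ t := by
  funext i
  ext ξ
  exact and_congr_right fun hi => and_congr_right fun hξ => h i hi ξ hξ

/-- The guess at `γ'` has unboundedly many flags. -/
def FlagsUnbounded (g : GuessSeq.{u}) (γ : Ordinal.{u}) : Prop :=
  ∀ ξ < γ, ∃ ζ, ξ < ζ ∧ ζ < γ ∧ (g γ ζ).side.flag

/-- The earlier non-accumulation points of `c` where the guess is compatible with that at `γ`. -/
def matchingPts (g : GuessSeq.{u}) (c : Set Ordinal.{u}) (γ : Ordinal.{u}) : Set Ordinal.{u} :=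
  {γ' | γ' ∈ naccPts c ∧ γ' < γ ∧ (∀ ξ < γ', (g γ' ξ).side = (g γ ξ).side) ∧ FlagsUnbounded g γ'}

theorem matchingPts_inter_Iio (g : GuessSeq.{u}) (c : Set Ordinal.{u}) (γ : Ordinal.{u}) :
    matchingPts g (c ∩ Iio γ) γ = matchingPts g c γ := by
  ext ξ
  simp only [matchingPts, naccPts_inter_Iio, mem_ofPred_eq, mem_inter_iff, mem_Iio]
  tauto

/-! ### The levels of the trees -/

/-- For one height: which pairs of a tree index and a node belong to the level, and which nodes
follow the instructions given at this height along a set of ordinals. -/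
structure LevelData : Type (u + 1) where
  lev : Set Ordinal.{u} → Set Ordinal.{u} → Prop
  ob : Set Ordinal.{u} → Set Ordinal.{u} → Set Ordinal.{u} → Prop

section Construction

variable (C : Ordinal.{u} → Set Ordinal.{u}) (g : GuessSeq.{u})

/-- The node `t` of the tree with index `H` is omitted at the limit height `γ`: it is guessed at
`γ`, and it does not follow the instructions along `C γ` eventually. -/
def KilledBy (γ : Ordinal.{u}) (prev : ∀ β < γ, LevelData.{u}) (H t : Set Ordinal.{u}) : Prop :=
  Order.IsSuccLimit γ ∧
    (∃ i < guessLen g γ, AgreeBelow γ (guessIdx g γ i) H ∧ AgreeBelow γ (guessTuple g γ i) t) ∧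
    -- Several guessed indices may coincide with `H` below `γ`. Requiring all their guessed nodes to
    -- be `t` keeps the omitted branch unique.
    (∀ i < guessLen g γ, AgreeBelow γ (guessIdx g γ i) H → AgreeBelow γ (guessTuple g γ i) t) ∧
    ¬ ∃ δ < γ, ∀ β, ∀ h : β < γ, β ∈ naccPts (C γ) → δ < β → (prev β h).ob (C γ) H t

/-- A tuple of nodes at height `γ` extending the tuple guessed at the last limit of matching
points, following the earlier instructions, and meeting the guessed target. -/
def GoodTuple (γ : Ordinal.{u}) (prev : ∀ β < γ, LevelData.{u})
    (lev : Set Ordinal.{u} → Set Ordinal.{u} → Prop) (c : Set Ordinal.{u})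
    (s : Ordinal.{u} → Set Ordinal.{u}) : Prop :=
  (∀ i < guessLen g γ,
    AgreeBelow (sSup (matchingPts g c γ)) (s i) (guessTuple g (sSup (matchingPts g c γ)) i) ∧
    lev (guessIdx g γ i) (s i) ∧
    ∀ β, ∀ h : β < γ, β ∈ naccPts c → sSup (matchingPts g c γ) < β →
      (prev β h).ob c (guessIdx g γ i) (s i)) ∧
  ∃ ζ < γ, normTuple (guessLen g γ) ζ s ∈ (g γ ζ).side.target

open Classical in
/-- The extension to height `γ` prescribed for the node `y` of height `p`. -/
noncomputable def prescribed (γ : Ordinal.{u}) (good : (Ordinal.{u} → Set Ordinal.{u}) → Prop)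
    (lev : Set Ordinal.{u} → Set Ordinal.{u} → Prop) (p : Ordinal.{u}) (H y : Set Ordinal.{u}) :
    Set Ordinal.{u} :=
  -- The tuple `epsilon good` does not depend on `H` or `y`, so nodes in different trees are steered
  -- into coordinates of the same tuple.
  if h : good (Classical.epsilon good) ∧ ∃ i < guessLen g γ, AgreeBelow γ (guessIdx g γ i) H ∧
      AgreeBelow p (Classical.epsilon good i) y then
    Classical.epsilon good h.2.choose
  else Classical.epsilon fun t => lev H t ∧ AgreeBelow p t y

/-- One step of the recursion. -/
noncomputable def levelStep (γ : Ordinal.{u}) (prev : ∀ β < γ, LevelData.{u}) : LevelData.{u} where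
  lev H t := (∀ β, ∀ h : β < γ, (prev β h).lev H t) ∧ ¬ KilledBy C g γ prev H t
  ob c H t := AgreeBelow γ t (prescribed g γ
    (GoodTuple g γ prev (fun H t => (∀ β, ∀ h : β < γ, (prev β h).lev H t) ∧
      ¬ KilledBy C g γ prev H t) (c ∩ Iio γ))
    (fun H t => (∀ β, ∀ h : β < γ, (prev β h).lev H t) ∧ ¬ KilledBy C g γ prev H t)
    (sSup (c ∩ Iio γ)) (H ∩ Iio γ) (t ∩ Iio (sSup (c ∩ Iio γ))))

/-- The recursive construction of the levels. -/
noncomputable def levelData (γ : Ordinal.{u}) : LevelData.{u} :=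
  levelStep C g γ fun β (_ : β < γ) => levelData β
termination_by γ

/-- `t ∩ γ` belongs to level `γ` of the tree with index `H`. -/
def Lev (γ : Ordinal.{u}) (H t : Set Ordinal.{u}) : Prop := (levelData C g γ).lev H t

/-- `t` follows the instructions at height `γ` along `c`. -/
def Obeys (γ : Ordinal.{u}) (c H t : Set Ordinal.{u}) : Prop := (levelData C g γ).ob c H t

/-- `t ∩ γ` is omitted from level `γ` of the tree with index `H`. -/
def Killed (γ : Ordinal.{u}) (H t : Set Ordinal.{u}) : Prop :=
  KilledBy C g γ (fun β _ => levelData C g β) H t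

/-- The tuples among which the instructions at height `γ` along `c` choose. -/
def Good (γ : Ordinal.{u}) (c : Set Ordinal.{u}) (s : Ordinal.{u} → Set Ordinal.{u}) : Prop :=
  GoodTuple g γ (fun β _ => levelData C g β) (Lev C g γ) c s

theorem lev_iff (γ : Ordinal.{u}) (H t : Set Ordinal.{u}) :
    Lev C g γ H t ↔ (∀ β < γ, Lev C g β H t) ∧ ¬ Killed C g γ H t := by
  rw [Lev, levelData]; rfl

theorem killed_iff (γ : Ordinal.{u}) (H t : Set Ordinal.{u}) : Killed C g γ H t ↔
    Order.IsSuccLimit γ ∧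
    (∃ i < guessLen g γ, AgreeBelow γ (guessIdx g γ i) H ∧ AgreeBelow γ (guessTuple g γ i) t) ∧
    (∀ i < guessLen g γ, AgreeBelow γ (guessIdx g γ i) H → AgreeBelow γ (guessTuple g γ i) t) ∧
    ¬ ∃ δ < γ, ∀ β < γ, β ∈ naccPts (C γ) → δ < β → Obeys C g β (C γ) H t := Iff.rfl

theorem good_iff (γ : Ordinal.{u}) (c : Set Ordinal.{u}) (s : Ordinal.{u} → Set Ordinal.{u}) :
    Good C g γ c s ↔
    (∀ i < guessLen g γ,
      AgreeBelow (sSup (matchingPts g c γ)) (s i) (guessTuple g (sSup (matchingPts g c γ)) i) ∧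
      Lev C g γ (guessIdx g γ i) (s i) ∧
      ∀ β < γ, β ∈ naccPts c → sSup (matchingPts g c γ) < β →
        Obeys C g β c (guessIdx g γ i) (s i)) ∧
    ∃ ζ < γ, normTuple (guessLen g γ) ζ s ∈ (g γ ζ).side.target := Iff.rfl

theorem obeys_iff (γ : Ordinal.{u}) (c H t : Set Ordinal.{u}) : Obeys C g γ c H t ↔
    AgreeBelow γ t (prescribed g γ (Good C g γ (c ∩ Iio γ)) (Lev C g γ) (sSup (c ∩ Iio γ))
      (H ∩ Iio γ) (t ∩ Iio (sSup (c ∩ Iio γ)))) := by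
  have : Lev C g γ = fun H t => (∀ β, ∀ _ : β < γ, (levelData C g β).lev H t) ∧
      ¬ KilledBy C g γ (fun β _ => levelData C g β) H t := by
    funext H t
    exact propext (lev_iff C g γ H t)
  unfold Good
  rw [this, Obeys, levelData]
  rfl

variable {C g}

theorem Obeys.congr {γ : Ordinal.{u}} {c c' H H' t t' : Set Ordinal.{u}}
    (h : Obeys C g γ c H t) (hc : AgreeBelow γ c c') (hH : AgreeBelow γ H H')
    (ht : AgreeBelow γ t t') : Obeys C g γ c' H' t' := by
  rw [obeys_iff] at h ⊢
  rw [← hc.inter_eq, ← hH.inter_eq, ← (ht.mono (sSup_inter_Iio_le c γ)).inter_eq]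
  exact ht.symm.trans h

theorem agreeBelow_naccPts {γ : Ordinal.{u}} {c c' : Set Ordinal.{u}} (hc : AgreeBelow γ c c') :
    AgreeBelow γ (naccPts c) (naccPts c') := by
  apply AgreeBelow.of_inter_eq
  rw [← naccPts_inter_Iio, ← naccPts_inter_Iio, hc.inter_eq]

theorem Killed.congr {γ : Ordinal.{u}} {H H' t t' : Set Ordinal.{u}} (h : Killed C g γ H t)
    (hH : AgreeBelow γ H H') (ht : AgreeBelow γ t t') : Killed C g γ H' t' := by
  rw [killed_iff] at h ⊢
  obtain ⟨h1, ⟨i, hi, h2, h3⟩, h4, h5⟩ := h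
  refine ⟨h1, ⟨i, hi, h2.trans hH, h3.trans ht⟩, fun j hj h => (h4 j hj (h.trans hH.symm)).trans ht,
    fun ⟨δ, hδ, h⟩ => h5 ⟨δ, hδ, fun β hβ hn hlt => ?_⟩⟩
  exact (h β hβ hn hlt).congr (.refl _ _) (hH.symm.mono hβ.le) (ht.symm.mono hβ.le)

/-- Everything in the recursion up to `γ` reads `H` and `t` below `γ` only, so arbitrary sets of
ordinals may stand for nodes. -/
theorem Lev.congr {γ : Ordinal.{u}} {H H' t t' : Set Ordinal.{u}} (h : Lev C g γ H t)
    (hH : AgreeBelow γ H H') (ht : AgreeBelow γ t t') : Lev C g γ H' t' := by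
  induction γ using WellFoundedLT.induction with
  | ind γ ih =>
    rw [lev_iff] at h ⊢
    exact ⟨fun β hβ => ih β hβ (h.1 β hβ) (hH.mono hβ.le) (ht.mono hβ.le),
      fun hk => h.2 (hk.congr hH.symm ht.symm)⟩

theorem Lev.mono {β γ : Ordinal.{u}} {H t : Set Ordinal.{u}} (h : Lev C g γ H t) (hβ : β ≤ γ) :
    Lev C g β H t := by
  obtain rfl | hβ := hβ.eq_or_lt
  · exact h
  · exact ((lev_iff C g γ H t).1 h).1 β hβ

theorem lev_zero (H t : Set Ordinal.{u}) : Lev C g 0 H t := by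
  rw [lev_iff]
  refine ⟨fun β hβ => absurd hβ not_lt_zero, fun hk => ?_⟩
  exact ((killed_iff C g _ _ _).1 hk).1.ne_bot rfl

theorem Lev.succ {β : Ordinal.{u}} {H t : Set Ordinal.{u}} (h : Lev C g β H t) :
    Lev C g (Order.succ β) H t := by
  rw [lev_iff]
  refine ⟨fun δ hδ => h.mono (Order.lt_succ_iff.1 hδ), fun hk => ?_⟩
  exact Order.not_isSuccLimit_succ β ((killed_iff C g _ _ _).1 hk).1

/-- At most one branch is omitted from each limit level. -/
theorem Killed.unique {γ : Ordinal.{u}} {H t t' : Set Ordinal.{u}} (h : Killed C g γ H t)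
    (h' : Killed C g γ H t') : AgreeBelow γ t t' := by
  obtain ⟨-, ⟨i, hi, h2, h3⟩, -, -⟩ := (killed_iff C g _ _ _).1 h
  exact h3.symm.trans (((killed_iff C g _ _ _).1 h').2.2.1 i hi h2)

/-- The prescribed extension obeys, belongs to the level, and is an extension. -/
theorem exists_obeys {γ : Ordinal.{u}} {c H y : Set Ordinal.{u}}
    (hy : ∃ t, Lev C g γ H t ∧ AgreeBelow (sSup (c ∩ Iio γ)) t y) :
    ∃ t, Lev C g γ H t ∧ AgreeBelow (sSup (c ∩ Iio γ)) t y ∧ Obeys C g γ c H t := by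
  set p := sSup (c ∩ Iio γ) with hp
  set t := prescribed g γ (Good C g γ (c ∩ Iio γ)) (Lev C g γ) p (H ∩ Iio γ) (y ∩ Iio p) with ht
  have key : Lev C g γ H t ∧ AgreeBelow p t y := by
    unfold prescribed at ht
    split_ifs at ht with h
    · obtain ⟨h1, h2, h3⟩ := h.2.choose_spec
      rw [← ht] at h3
      refine ⟨?_, h3.trans (.inter_Iio _ le_rfl)⟩
      have := (((good_iff C g _ _ _).1 h.1).1 _ h1).2.1
      rw [← ht] at this
      exact this.congr (h2.trans (.inter_Iio _ le_rfl)) (.refl _ _)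
    · have : ∃ t, Lev C g γ (H ∩ Iio γ) t ∧ AgreeBelow p t (y ∩ Iio p) := by
        obtain ⟨t, h1, h2⟩ := hy
        exact ⟨t, h1.congr (AgreeBelow.inter_Iio _ le_rfl).symm (.refl _ _),
          h2.trans (AgreeBelow.inter_Iio _ le_rfl).symm⟩
      have h' := Classical.epsilon_spec this
      rw [← ht] at h'
      exact ⟨h'.1.congr (.inter_Iio _ le_rfl) (.refl _ _), h'.2.trans (.inter_Iio _ le_rfl)⟩
  refine ⟨t, key.1, key.2, ?_⟩
  rw [obeys_iff, ← hp, key.2.inter_eq]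
  exact .refl _ _

/-- Both nodes must equal the one prescription computed from their common part below `sSup (c ∩ Iio
γ)`. -/
theorem Obeys.unique {γ : Ordinal.{u}} {c H t t' : Set Ordinal.{u}}
    (h : Obeys C g γ c H t) (h' : Obeys C g γ c H t')
    (hy : AgreeBelow (sSup (c ∩ Iio γ)) t t') : AgreeBelow γ t t' := by
  rw [obeys_iff] at h h'
  rw [← hy.inter_eq] at h'
  exact h.trans h'.symm

end Construction

/-! ### Coherent sequences of clubs -/

/-- The properties of a `⊑`-coherent `C`-sequence, expressed through limit points. -/
structure IsCoherentClubSeq (κ : Cardinal.{u}) (C : Ordinal.{u} → Set Ordinal.{u}) : Prop where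
  lt : ∀ α < κ.ord, ∀ β ∈ C α, β < α
  closed : ∀ α < κ.ord, ∀ β < α, IsLimPt (C α) β → β ∈ C α
  isLimPt : ∀ α < κ.ord, Order.IsSuccLimit α → IsLimPt (C α) α
  coherent : ∀ α < κ.ord, ∀ β < α, IsLimPt (C α) β → AgreeBelow β (C α) (C β)

theorem sSup_Iio_of_isSuccLimit {α : Ordinal.{u}} (hα : Order.IsSuccLimit α) :
    sSup (Iio α) = α := by
  have := (isLimPt_iff univ α).1 ⟨hα.bot_lt, fun ξ hξ =>
    ⟨Order.succ ξ, mem_univ _, Order.lt_succ ξ, hα.succ_lt hξ⟩⟩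
  simpa using this.1

theorem IsCSequence.isCoherentClubSeq {κ : Cardinal.{u}} {C : Ordinal.{u} → Set Ordinal.{u}}
    (h : IsCSequence κ C) (hc : IsCoherentSeq κ InitSegOf C) : IsCoherentClubSeq κ C := by
  have hcl : ∀ α < κ.ord, ∀ β < α, IsLimPt (C α) β → β ∈ C α := fun α hα β hβ hl =>
    (h α hα).2.1 β hβ hl.1 ((isLimPt_iff _ _).1 hl).1
  refine ⟨fun α hα β hβ => (h α hα).1 hβ, hcl, fun α hα hl => ?_, fun α hα β hβ hl => ?_⟩
  · rw [isLimPt_iff, inter_eq_left.2 (h α hα).1, (h α hα).2.2]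
    exact ⟨sSup_Iio_of_isSuccLimit hl, hl.bot_lt⟩
  -- The initial segment `C β = C α ∩ γ` might a priori be cut too early; `sSup (C β) = β` excludes
  -- `γ < β`.
  · obtain ⟨γ, hγ⟩ := hc α hα β hβ (mem_accPts_iff.2 ⟨hcl α hα β hβ hl, hl⟩)
    have hle : β ≤ γ := by
      rw [← sSup_Iio_of_isSuccLimit hl.isSuccLimit, ← (h β (hβ.trans hα)).2.2, hγ]
      exact sSup_inter_Iio_le _ _
    rw [hγ]
    exact (AgreeBelow.inter_Iio _ hle).symm

/-- The supremum is either attained or a limit point of `c`. At a non-accumulation point `γ` it is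
thus the last point of `c` before `γ`. -/
theorem sSup_inter_Iio_mem {c : Set Ordinal.{u}} {γ ζ : Ordinal.{u}}
    (hc : ∀ β ≤ γ, IsLimPt c β → β ∈ c) (hζ : ζ ∈ c) (hζγ : ζ < γ) :
    sSup (c ∩ Iio γ) ∈ c := by
  set p := sSup (c ∩ Iio γ) with hp
  by_contra hpc
  have hle : ∀ ζ ∈ c, ζ < γ → ζ < p := fun ζ h1 h2 =>
    lt_of_le_of_ne (le_csSup (bddAbove_inter_Iio c γ) (show ζ ∈ c ∩ Iio γ from ⟨h1, h2⟩))
      (by rintro rfl; exact hpc h1)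
  refine hpc (hc p (sSup_inter_Iio_le c γ) ⟨(zero_le).trans_lt (hle ζ hζ hζγ), fun ξ hξ => ?_⟩)
  obtain ⟨η, h1, h2⟩ := exists_lt_of_lt_csSup (s := c ∩ Iio γ) ⟨ζ, hζ, hζγ⟩ (hp ▸ hξ)
  exact ⟨η, h1.1, h2, hle η h1.1 h1.2⟩

theorem sSup_inter_Iio_lt {c : Set Ordinal.{u}} {γ : Ordinal.{u}} (h0 : 0 < γ)
    (h : ¬ IsLimPt c γ) : sSup (c ∩ Iio γ) < γ :=
  lt_of_le_of_ne (sSup_inter_Iio_le c γ) fun h' => h ((isLimPt_iff c γ).2 ⟨h', h0⟩)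

/-! ### Extensions following the instructions, and normality. -/

section

variable {κ : Cardinal.{u}} {C : Ordinal.{u} → Set Ordinal.{u}} {g : GuessSeq.{u}}

/-- Nodes following the instructions are determined by their restrictions. -/
theorem agreeBelow_of_obeys {c H t t' : Set Ordinal.{u}} {β ξ : Ordinal.{u}}
    (hc : ∀ γ ≤ ξ, IsLimPt c γ → γ ∈ c) (hβ : β ∈ c) (hξ : ξ ∈ c) (hβξ : β ≤ ξ)
    (h : AgreeBelow β t t')
    (ht : ∀ γ ∈ naccPts c, β < γ → γ ≤ ξ → Obeys C g γ c H t)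
    (ht' : ∀ γ ∈ naccPts c, β < γ → γ ≤ ξ → Obeys C g γ c H t') : AgreeBelow ξ t t' := by
  induction ξ using WellFoundedLT.induction with
  | ind ξ ih =>
    obtain rfl | hlt := hβξ.eq_or_lt
    · exact h
    have ih' : ∀ η ∈ c, β ≤ η → η < ξ → AgreeBelow η t t' := fun η hη h1 h2 =>
      ih η h2 (fun γ hγ => hc γ (hγ.trans h2.le)) hη h1
        (fun γ hn h3 h4 => ht γ hn h3 (h4.trans h2.le))
        (fun γ hn h3 h4 => ht' γ hn h3 (h4.trans h2.le))
    by_cases hl : IsLimPt c ξ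
    · intro ζ hζ
      obtain ⟨η, h1, h2, h3⟩ := hl.2 _ (max_lt hζ hlt)
      exact ih' η h1 ((le_max_right _ _).trans h2.le) h3 ζ ((le_max_left _ _).trans_lt h2)
    · have hn := mem_naccPts_iff.2 ⟨hξ, hl⟩
      refine (ht ξ hn hlt le_rfl).unique (ht' ξ hn hlt le_rfl) (ih' _ ?_ ?_ ?_)
      · exact sSup_inter_Iio_mem hc hβ hlt
      · exact le_csSup (bddAbove_inter_Iio c ξ) ⟨hβ, hlt⟩
      · exact sSup_inter_Iio_lt ((zero_le).trans_lt hlt) hl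

variable (C g) in
/-- `t` extends the node `y` of height `δ` to height `ξ`, following the instructions along `c`. -/
def ObeyingExtension (c H y : Set Ordinal.{u}) (δ ξ : Ordinal.{u}) (t : Set Ordinal.{u}) : Prop :=
  AgreeBelow δ t y ∧ Lev C g ξ H t ∧ ∀ γ ∈ naccPts c, δ < γ → γ ≤ ξ → Obeys C g γ c H t

theorem ObeyingExtension.congr {c H y t t' : Set Ordinal.{u}} {δ ξ : Ordinal.{u}}
    (h : ObeyingExtension C g c H y δ ξ t) (hδ : δ ≤ ξ) (ht : AgreeBelow ξ t t') :
    ObeyingExtension C g c H y δ ξ t' :=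
  ⟨(ht.symm.mono hδ).trans h.1, h.2.1.congr (.refl _ _) ht, fun γ hn h1 h2 =>
    (h.2.2 γ hn h1 h2).congr (.refl _ _) (.refl _ _) (ht.mono h2)⟩

/-- By `agreeBelow_of_obeys`, extensions of `y` that follow the instructions are unique up to their
heights, so arbitrary choices cohere and their union works. -/
theorem ObeyingExtension.glue {c H y : Set Ordinal.{u}} {δ l : Ordinal.{u}} (hδ : δ ∈ c)
    (hc : ∀ γ < l, IsLimPt c γ → γ ∈ c)
    (h : ∀ η ∈ c, δ ≤ η → η < l → ∃ t, ObeyingExtension C g c H y δ η t) :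
    ∃ t, ∀ η ∈ c, δ ≤ η → η < l → ObeyingExtension C g c H y δ η t := by
  choose! T hT using h
  have hu : ∀ η ∈ c, δ ≤ η → η < l → ∀ η' ∈ c, η ≤ η' → η' < l → AgreeBelow η (T η) (T η') := by
    intro η h1 h2 h3 η' h4 h5 h6
    have e := hT η h1 h2 h3
    have e' := hT η' h4 (h2.trans h5) h6
    exact agreeBelow_of_obeys (fun γ hγ => hc γ (hγ.trans_lt h3)) hδ h1 h2 (e.1.trans e'.1.symm)
      e.2.2 (fun γ hn h7 h8 => e'.2.2 γ hn h7 (h8.trans h5))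
  refine ⟨{ζ | ∃ η ∈ c, δ ≤ η ∧ η < l ∧ ζ < η ∧ ζ ∈ T η}, fun η h1 h2 h3 => ?_⟩
  refine (hT η h1 h2 h3).congr h2 fun ζ hζ => ⟨fun h => ⟨η, h1, h2, h3, hζ, h⟩, ?_⟩
  rintro ⟨η', h4, h5, h6, h7, h8⟩
  obtain hle | hle := le_total η η'
  · exact (hu η h1 h2 h3 η' h4 hle h6 ζ hζ).2 h8
  · exact (hu η' h4 h5 h6 η h1 hle h3 ζ h7).1 h8

/-- Since `c` and `C l` agree below `l`, following the instructions along `c` above `δ` refutes the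
last clause of `killed_iff` at `l`. -/
theorem lev_of_obeyingExtension {c H y t : Set Ordinal.{u}} {δ l : Ordinal.{u}}
    (hδ : δ < l) (hl : IsLimPt c l) (hc : AgreeBelow l c (C l))
    (h : ∀ η ∈ c, δ ≤ η → η < l → ObeyingExtension C g c H y δ η t) : Lev C g l H t := by
  rw [lev_iff]
  constructor
  · intro β hβ
    obtain ⟨η, h1, h2, h3⟩ := hl.2 _ (max_lt hβ hδ)
    exact (h η h1 ((le_max_right _ _).trans h2.le) h3).2.1.mono ((le_max_left _ _).trans h2.le)
  · intro hk
    refine ((killed_iff C g _ _ _).1 hk).2.2.2 ⟨δ, hδ, fun β hβ hn hlt => ?_⟩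
    have hn' := (agreeBelow_naccPts hc β hβ).2 hn
    exact ((h β (mem_naccPts_iff.1 hn').1 hlt.le hβ).2.2 β hn' hlt le_rfl).congr
      (hc.mono hβ.le) (.refl _ _) (.refl _ _)

variable (hC : IsCoherentClubSeq κ C)
include hC

/-- Climb along `C α`: at non-accumulation points take the prescribed extension, at limit points
glue. The hypothesis `hN` is normality below `α`, the induction hypothesis of
`exists_lev_extension`. -/
theorem exists_obeyingExtension {α : Ordinal.{u}} (hα : α < κ.ord) {H y : Set Ordinal.{u}}
    (hN : ∀ γ < α, ∀ β ≤ γ, ∀ y, Lev C g β H y → ∃ t, Lev C g γ H t ∧ AgreeBelow β t y)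
    {δ : Ordinal.{u}} (hδ : δ ∈ C α) (hy : Lev C g δ H y) {ξ : Ordinal.{u}} (hξ : ξ ∈ C α)
    (hδξ : δ ≤ ξ) : ∃ t, ObeyingExtension C g (C α) H y δ ξ t := by
  induction ξ using WellFoundedLT.induction with
  | ind ξ ih =>
    have hξα := hC.lt α hα ξ hξ
    obtain rfl | hlt := hδξ.eq_or_lt
    · exact ⟨y, .refl _ _, hy, fun γ _ h1 h2 => absurd h1 h2.not_gt⟩
    by_cases hl : IsLimPt (C α) ξ
    · obtain ⟨t, ht⟩ := ObeyingExtension.glue (C := C) (g := g) (H := H) (y := y) (l := ξ) hδ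
        (fun γ hγ => hC.closed α hα γ (hγ.trans hξα)) fun η h1 h2 h3 => ih η h3 h1 h2
      refine ⟨t, (ht δ hδ le_rfl hlt).1,
        lev_of_obeyingExtension hlt hl (hC.coherent α hα ξ hξα hl) ht, fun γ hn h1 h2 => ?_⟩
      have hγ := mem_naccPts_iff.1 hn
      refine (ht γ hγ.1 h1.le (lt_of_le_of_ne h2 ?_)).2.2 γ hn h1 le_rfl
      rintro rfl
      exact hγ.2 hl
    · set p := sSup (C α ∩ Iio ξ) with hp
      have hpC : p ∈ C α := sSup_inter_Iio_mem
        (fun γ hγ => hC.closed α hα γ (hγ.trans_lt hξα)) hδ hlt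
      have hpξ : p < ξ := sSup_inter_Iio_lt ((zero_le).trans_lt hlt) hl
      have hδp : δ ≤ p := le_csSup (bddAbove_inter_Iio _ ξ) ⟨hδ, hlt⟩
      obtain ⟨t₀, h0⟩ := ih p hpξ hpC hδp
      obtain ⟨t, h1, h2, h3⟩ := exists_obeys (c := C α) (hN ξ hξα p hpξ.le t₀ h0.2.1)
      rw [← hp] at h2
      have h0' := h0.congr hδp h2.symm
      refine ⟨t, h0'.1, h1, fun γ hn h4 h5 => ?_⟩
      obtain rfl | h5 := h5.eq_or_lt
      · exact h3
      · exact h0'.2.2 γ hn h4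
          (le_csSup (bddAbove_inter_Iio _ ξ) ⟨(mem_naccPts_iff.1 hn).1, h5⟩)

/-- Every node has extensions to all higher levels. -/
theorem exists_lev_extension {α : Ordinal.{u}} (hα : α < κ.ord) {β : Ordinal.{u}} (hβ : β ≤ α)
    {H y : Set Ordinal.{u}} (hy : Lev C g β H y) : ∃ t, Lev C g α H t ∧ AgreeBelow β t y := by
  induction α using WellFoundedLT.induction generalizing β y with
  | ind α ih =>
    obtain rfl | hlt := hβ.eq_or_lt
    · exact ⟨y, hy, .refl _ _⟩
    obtain rfl | ⟨a, rfl⟩ | hl := Ordinal.zero_or_succ_or_isSuccLimit α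
    · exact absurd hlt not_lt_zero
    · have ha := Order.lt_succ a
      obtain ⟨t, h1, h2⟩ := ih a ha (ha.trans hα) (Order.lt_succ_iff.1 hlt) hy
      exact ⟨t, h1.succ, h2⟩
    -- Move up to a point `δ` of `C α` first; from there the union of the obeying extensions is a
    -- branch that is not omitted at `α`.
    · have hlp := hC.isLimPt α hα hl
      obtain ⟨δ, h1, h2, h3⟩ := hlp.2 β hlt
      obtain ⟨y₀, h4, h5⟩ := ih δ h3 (h3.trans hα) h2.le hy
      obtain ⟨t, ht⟩ := ObeyingExtension.glue (C := C) (g := g) (H := H) (y := y₀) (l := α) h1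
        (fun γ hγ => hC.closed α hα γ hγ) fun η h6 h7 h8 =>
          exists_obeyingExtension hC hα
            (fun γ hγ β hβ y hy => ih γ hγ (hγ.trans hα) hβ hy) h1 h4 h6 h7
      exact ⟨t, lev_of_obeyingExtension h3 hlp (.refl _ _) ht,
        ((ht δ h1 le_rfl h3).1.mono h2.le).trans h5⟩

end

/-! ### Counting -/

theorem Cardinal.IsInaccessible.two_power_lt_lift {κ : Cardinal.{u}} (hκ : κ.IsInaccessible)
    {c : Cardinal.{u + 1}} (hc : c < Cardinal.lift.{u + 1} κ) :
    2 ^ c < Cardinal.lift.{u + 1} κ := by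
  obtain ⟨d, hd, rfl⟩ := Cardinal.lt_lift_iff.1 hc
  rw [← Cardinal.lift_two_power, Cardinal.lift_lt]
  exact hκ.isStrongPrelimit hd

theorem Cardinal.IsInaccessible.aleph0_le_lift {κ : Cardinal.{u}} (hκ : κ.IsInaccessible) :
    ℵ₀ ≤ Cardinal.lift.{u + 1} κ :=
  Cardinal.aleph0_le_lift.2 hκ.aleph0_lt.le

theorem Cardinal.IsInaccessible.mk_prod_lt {κ : Cardinal.{u}} (hκ : κ.IsInaccessible)
    {X Y : Type (u + 1)} (hX : #X < Cardinal.lift.{u + 1} κ) (hY : #Y < Cardinal.lift.{u + 1} κ) :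
    #(X × Y) < Cardinal.lift.{u + 1} κ := by
  rw [Cardinal.mk_prod, Cardinal.lift_id, Cardinal.lift_id]
  exact Cardinal.mul_lt_of_lt hκ.aleph0_le_lift hX hY

theorem Cardinal.IsInaccessible.mk_set_lt {κ : Cardinal.{u}} (hκ : κ.IsInaccessible)
    {X : Type (u + 1)} (hX : #X < Cardinal.lift.{u + 1} κ) :
    #(Set X) < Cardinal.lift.{u + 1} κ := by
  rw [Cardinal.mk_set]
  exact hκ.two_power_lt_lift hX

/-- The data that are bounded below `κ`. -/
def smallData (κ : Cardinal.{u}) : Set GuessDatum.{u} :=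
  {q | ∃ ε < κ.ord, q.col ⊆ Iio ε ∧ q.side.len < ε ∧ q.side.idx ⊆ Iio ε ∧
    ∀ τ ∈ q.side.target, normTuple ε ε τ = τ}

/-- The relation coding a tuple. -/
def tupleRel (ε : Ordinal.{u}) (τ : Ordinal.{u} → Set Ordinal.{u}) : Set (Iio ε × Iio ε) :=
  {p | p.2.1 ∈ τ p.1.1}

theorem tupleRel_injOn {ε : Ordinal.{u}} {τ τ' : Ordinal.{u} → Set Ordinal.{u}}
    (hτ : normTuple ε ε τ = τ) (hτ' : normTuple ε ε τ' = τ')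
    (h : tupleRel ε τ = tupleRel ε τ') : τ = τ' := by
  rw [← hτ, ← hτ']
  funext i
  ext ξ
  refine and_congr_right fun hi => and_congr_right fun hξ => ?_
  exact Set.ext_iff.1 h (⟨i, hi⟩, ⟨ξ, hξ⟩)

/-- The types in which the bounded data are coded. -/
abbrev DatumCode (ε : Ordinal.{u}) : Type (u + 1) :=
  Set (Iio ε) × Iio ε × Set (Iio ε) × Set (Set (Iio ε × Iio ε)) × Set PUnit.{u + 2}

/-- Coding of a datum bounded by `ε`. -/
def datumCode (q : GuessDatum.{u}) (ε : Ordinal.{u}) (h : q.side.len < ε) : DatumCode ε :=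
  ({x | x.1 ∈ q.col}, ⟨q.side.len, h⟩, {x | x.1 ∈ q.side.idx}, tupleRel ε '' q.side.target,
    {_x | q.side.flag})

theorem preimage_val_injOn {ε : Ordinal.{u}} {X Y : Set Ordinal.{u}} (hX : X ⊆ Iio ε)
    (hY : Y ⊆ Iio ε) (h : ({x | x.1 ∈ X} : Set (Iio ε)) = {x | x.1 ∈ Y}) : X = Y := by
  ext ξ
  exact ⟨fun hξ => (Set.ext_iff.1 h ⟨ξ, hX hξ⟩).1 hξ, fun hξ => (Set.ext_iff.1 h ⟨ξ, hY hξ⟩).2 hξ⟩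

/-- Data bounded by a fixed `ε < κ` number fewer than `κ`, as `κ` is a strong limit: the target is a
set of relations on `ε`, which costs two power sets. There are `κ` many bounds `ε`. -/
theorem mk_smallData_le {κ : Cardinal.{u}} (hκ : κ.IsInaccessible) :
    #(smallData κ) ≤ Cardinal.lift.{u + 1} κ := by
  choose ε hε h1 h2 h3 h4 using fun q : smallData κ => q.2
  let F : smallData κ → Σ δ : Iio κ.ord, DatumCode δ.1 := fun q =>
    ⟨⟨ε q, hε q⟩, datumCode q.1 (ε q) (h2 q)⟩
  have hF : Function.Injective F := by
    intro q q' h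
    have hε' : ε q = ε q' := congrArg (fun s => s.1.1) h
    have h2' : q'.1.side.len < ε q := hε' ▸ h2 q'
    have hcode : datumCode q.1 (ε q) (h2 q) = datumCode q'.1 (ε q) h2' := by
      have := (Sigma.mk.inj_iff.1 h).2
      have e : ∀ δ (hδ : ε q = δ) (h' : q'.1.side.len < δ),
          HEq (datumCode q'.1 δ h') (datumCode q'.1 (ε q) h2') := by
        rintro _ rfl _
        rfl
      exact eq_of_heq (this.trans (e _ hε' (h2 q')))
    have h1' := h1 q'
    have h3' := h3 q'
    have h4' := h4 q'
    rw [← hε'] at h1' h3' h4'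
    simp only [datumCode, Prod.mk.injEq] at hcode
    obtain ⟨e1, e2, e3, e4, e5⟩ := hcode
    refine Subtype.ext (GuessDatum.ext (preimage_val_injOn (h1 q) h1' e1)
      (SideDatum.ext (Subtype.ext_iff.1 e2) (preimage_val_injOn (h3 q) h3' e3) ?_ ?_))
    · ext τ
      constructor
      · intro hτ
        obtain ⟨τ', hτ', he⟩ := e4.subset (mem_image_of_mem _ hτ)
        rwa [← tupleRel_injOn (h4' τ' hτ') (h4 q τ hτ) he]
      · intro hτ
        obtain ⟨τ', hτ', he⟩ := e4.symm.subset (mem_image_of_mem _ hτ)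
        rwa [← tupleRel_injOn (h4 q τ' hτ') (h4' τ hτ) he]
    · exact propext (Set.ext_iff.1 e5 PUnit.unit)
  have hι : #(Iio κ.ord) = Cardinal.lift.{u + 1} κ := by
    rw [Cardinal.mk_Iio_ordinal, Cardinal.card_ord]
  calc #(smallData κ) ≤ #(Σ δ : Iio κ.ord, DatumCode δ.1) := Cardinal.mk_le_of_injective hF
    _ = Cardinal.sum fun δ : Iio κ.ord => #(DatumCode δ.1) := Cardinal.mk_sigma _
    _ ≤ Cardinal.sum fun _ : Iio κ.ord => Cardinal.lift.{u + 1} κ := by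
      refine Cardinal.sum_le_sum _ _ fun δ => ?_
      have hδ : #(Iio δ.1) < Cardinal.lift.{u + 1} κ := mk_Iio_lt_of_lt_ord δ.2
      refine (hκ.mk_prod_lt (hκ.mk_set_lt hδ) (hκ.mk_prod_lt hδ (hκ.mk_prod_lt (hκ.mk_set_lt hδ)
        (hκ.mk_prod_lt (hκ.mk_set_lt (hκ.mk_set_lt (hκ.mk_prod_lt hδ hδ)))
          (hκ.mk_set_lt ?_))))).le
      exact (Cardinal.lt_aleph0_of_finite _).trans_le hκ.aleph0_le_lift
    _ = Cardinal.lift.{u + 1} κ := by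
      rw [Cardinal.sum_const', hι, Cardinal.mul_eq_self hκ.aleph0_le_lift]

/-! ### Guessing sequences of data -/

theorem toZFSet_mem_HSet {κ : Cardinal.{u}} {o : Ordinal.{u}} (ho : o < κ.ord) :
    o.toZFSet ∈ HSet κ := by
  induction o using WellFoundedLT.induction with
  | ind o ih =>
    refine ZFSet.hereditarily_iff.2 ⟨?_, fun y hy => ?_⟩
    · rw [Ordinal.card_toZFSet]
      exact Cardinal.lt_ord.1 ho
    · obtain ⟨a, ha, rfl⟩ := Ordinal.mem_toZFSet_iff.1 hy
      exact ih a ha (ha.trans ho)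

/-- The transfinite sequence of codes of the data `z ξ` for `ξ < α`. -/
noncomputable def codeSeq (e : GuessDatum.{u} → Ordinal.{u}) (z : Ordinal.{u} → GuessDatum.{u})
    (α : Ordinal.{u}) : OrdSeq.{u} := ⟨α, fun ξ => (e (z ξ.1)).toZFSet⟩

instance : Nonempty GuessDatum.{u} := ⟨⟨∅, ⟨0, ∅, ∅, True⟩⟩⟩

open Classical in
/-- Decoding of a transfinite sequence of codes. -/
noncomputable def decodeSeq (e : GuessDatum.{u} → Ordinal.{u}) (A : Set GuessDatum.{u})
    (s : OrdSeq.{u}) (ξ : Ordinal.{u}) : GuessDatum.{u} :=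
  if h : ξ < s.len then Function.invFunOn (fun q => (e q).toZFSet) A (s.val ⟨ξ, h⟩)
  else Classical.arbitrary _

/-- Small data are coded by ordinals below `κ`, so the initial segments of the streams in `Z` form a
streamlined tree, and its levels are small by assumption. Decoding the `◊*` sequence for this tree
gives `g`, which does not depend on `Z`. -/
theorem exists_guessSeq {κ : Cardinal.{u}} (hκ : κ.IsInaccessible) {S : Set Ordinal.{u}}
    (hD : DiamondStarTrees κ S (Iio κ.ord)) :
    ∃ g : GuessSeq.{u}, ∀ Z : Set (Ordinal.{u} → GuessDatum.{u}), Z.Nonempty →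
      (∀ z ∈ Z, ∀ ξ < κ.ord, z ξ ∈ smallData κ) →
      (∀ α < κ.ord, #(range fun z : Z => fun ξ : Iio α => z.1 ξ.1) < Cardinal.lift.{u + 1} κ) →
      ∃ D : Set Ordinal.{u}, ClubIn κ.ord D ∧ ∀ α ∈ S ∩ D, α < κ.ord → ∀ z ∈ Z,
        StationaryIn α {β | β < α ∧ ∀ ξ < β, g β ξ = z ξ} := by
  obtain ⟨f, hf⟩ := hD
  have hcard : #(smallData κ) ≤ #(Iio κ.ord) := by
    rw [Cardinal.mk_Iio_ordinal, Cardinal.card_ord]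
    exact mk_smallData_le hκ
  obtain ⟨⟨e₀, he₀⟩⟩ := hcard
  classical
  let e : GuessDatum.{u} → Ordinal.{u} := fun q => if h : q ∈ smallData κ then (e₀ ⟨q, h⟩).1 else 0
  have he : InjOn (fun q => (e q).toZFSet) (smallData κ) := by
    intro q hq q' hq' h
    have := Ordinal.toZFSet_injective h
    simp only [e, dif_pos hq, dif_pos hq'] at this
    exact Subtype.ext_iff.1 (he₀ (Subtype.ext this))
  have hlt : ∀ q ∈ smallData κ, e q < κ.ord := by
    intro q hq
    simp only [e, dif_pos hq]
    exact (e₀ ⟨q, hq⟩).2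
  refine ⟨fun β => decodeSeq e (smallData κ) (f β), fun Z hne hZ hsmall => ?_⟩
  set T : Set OrdSeq.{u} := {s | ∃ z ∈ Z, ∃ α < κ.ord, s = codeSeq e z α} with hT
  obtain ⟨D, hD1, hD2⟩ := hf T
    { len_lt := by
        rintro _ ⟨z, -, α, hα, rfl⟩
        exact hα
      val_mem := by
        rintro _ ⟨z, hz, α, hα, rfl⟩ i
        exact toZFSet_mem_HSet (hlt _ (hZ z hz _ (lt_trans i.2 hα)))
      restrict_mem := by
        rintro _ ⟨z, hz, α, hα, rfl⟩ β hβ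
        exact ⟨z, hz, min α β, (min_le_left _ _).trans_lt hα, rfl⟩
      nonempty := by
        intro α hα
        obtain ⟨z, hz⟩ := hne
        exact ⟨_, ⟨z, hz, α, hα, rfl⟩, rfl⟩
      small := by
        intro α hα
        refine lt_of_le_of_lt ?_ (hsmall α hα)
        have hsub : {t : OrdSeq.{u} | t ∈ T ∧ t.len = α} ⊆
            (fun w : Iio α → GuessDatum.{u} => (⟨α, fun ξ => (e (w ξ)).toZFSet⟩ : OrdSeq.{u})) ''
              (range fun z : Z => fun ξ : Iio α => z.1 ξ.1) := by
          rintro _ ⟨⟨z, hz, β, hβ, rfl⟩, h⟩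
          obtain rfl : β = α := h
          exact ⟨_, ⟨⟨z, hz⟩, rfl⟩, rfl⟩
        exact (Cardinal.mk_le_mk_of_subset hsub).trans Cardinal.mk_image_le }
  refine ⟨D, hD1, fun α hα hακ z hz => ?_⟩
  refine IsStationary.mono (hD2 α hα (codeSeq e z α) ⟨z, hz, α, hακ, rfl⟩ rfl) ?_
  rintro β ⟨-, h1, h2⟩
  refine ⟨h1, fun ξ hξ => ?_⟩
  change decodeSeq e (smallData κ) (f β.1) ξ = z ξ
  rw [← h2]
  refine (dif_pos (show ξ < min α β.1 from lt_min (hξ.trans h1) hξ)).trans ?_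
  exact he.leftInvOn_invFunOn (hZ z hz ξ ((hξ.trans h1).trans hακ))

/-- The stream of data given by a tuple of length `θ` and side information. -/
def tupleStream (θ : Ordinal.{u}) (side : Ordinal.{u} → SideDatum.{u})
    (τ : Ordinal.{u} → Set Ordinal.{u}) (ξ : Ordinal.{u}) : GuessDatum.{u} :=
  ⟨{i | i < θ ∧ ξ ∈ τ i}, side ξ⟩

theorem normTuple_eq_of_le {θ ξ ε : Ordinal.{u}} (hθ : θ ≤ ε) (hξ : ξ ≤ ε)
    {τ : Ordinal.{u} → Set Ordinal.{u}} (h : normTuple θ ξ τ = τ) : normTuple ε ε τ = τ := by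
  rw [← h]
  funext i
  ext ζ
  exact ⟨fun h => h.2.2, fun h => ⟨h.1.trans_le hθ, h.2.1.trans_le hξ, h⟩⟩

/-- `g` guesses all tuples, together with any side information, stationarily often at a club of
points of `S`. -/
def GuessesTuples (κ : Cardinal.{u}) (S : Set Ordinal.{u}) (g : GuessSeq.{u}) : Prop :=
  ∀ θ < κ.ord, ∀ side : Ordinal.{u} → SideDatum.{u},
    (∀ ξ, (side ξ).len = θ ∧ (side ξ).idx ⊆ Iio θ ∧ ∀ τ ∈ (side ξ).target, normTuple θ ξ τ = τ) →
    ∃ D : Set Ordinal.{u}, ClubIn κ.ord D ∧ ∀ α ∈ S ∩ D, α < κ.ord → ∀ τ,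
      StationaryIn α {β | β < α ∧ ∀ ξ < β, g β ξ = tupleStream θ side τ ξ}

/-- With `θ` and the side information fixed, a stream restricted to `α` is determined by a relation
on `θ × α`, so there are fewer than `κ` restrictions. -/
theorem exists_guessesTuples {κ : Cardinal.{u}} (hκ : κ.IsInaccessible) {S : Set Ordinal.{u}}
    (hD : DiamondStarTrees κ S (Iio κ.ord)) : ∃ g : GuessSeq.{u}, GuessesTuples κ S g := by
  obtain ⟨g, hg⟩ := exists_guessSeq hκ hD
  have hlim := Cardinal.isSuccLimit_ord hκ.aleph0_lt.le
  refine ⟨g, fun θ hθ side hside => ?_⟩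
  suffices h : _ ∧ _ by
    obtain ⟨D, hD1, hD2⟩ := hg (range (tupleStream θ side)) (range_nonempty _) h.1 h.2
    exact ⟨D, hD1, fun α hα hακ τ => hD2 α hα hακ _ ⟨τ, rfl⟩⟩
  constructor
  · rintro _ ⟨τ, rfl⟩ ξ hξ
    have hmax := Order.lt_succ (max θ ξ)
    have hθ' : θ < Order.succ (max θ ξ) := (le_max_left _ _).trans_lt hmax
    refine ⟨Order.succ (max θ ξ), hlim.succ_lt (max_lt hθ hξ), fun i hi => hi.1.trans hθ', ?_, ?_,
      fun τ hτ => normTuple_eq_of_le hθ'.le ((le_max_right _ _).trans hmax.le)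
        ((hside ξ).2.2 τ hτ)⟩
    · exact (hside ξ).1.trans_lt hθ'
    · exact (hside ξ).2.1.trans fun i hi => (mem_Iio.1 hi).trans hθ'
  · intro α hα
    refine lt_of_le_of_lt ?_ (hκ.mk_set_lt (hκ.mk_prod_lt (mk_Iio_lt_of_lt_ord hθ)
      (mk_Iio_lt_of_lt_ord hα)))
    have hsub : (range fun z : range (tupleStream θ side) => fun ξ : Iio α => z.1 ξ.1) ⊆
        range fun R : Set (Iio θ × Iio α) => fun ξ : Iio α =>
          (⟨{i | ∃ h : i < θ, (⟨i, h⟩, ξ) ∈ R}, side ξ.1⟩ : GuessDatum.{u}) := by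
      rintro _ ⟨⟨_, τ, rfl⟩, rfl⟩
      refine ⟨{p | p.2.1 ∈ τ p.1.1}, ?_⟩
      funext ξ
      simp [tupleStream]
    exact (Cardinal.mk_le_mk_of_subset hsub).trans Cardinal.mk_range_le

/-- If all subsets of `α` are guessed stationarily often below `α`, then `α` is regular. -/
theorem ord_cof_eq_of_guesses {α : Ordinal.{u}} (hα : ℵ₀ < α.cof) {g : GuessSeq.{u}}
    {side : Ordinal.{u} → SideDatum.{u}}
    (h : ∀ τ, StationaryIn α {β | β < α ∧ ∀ ξ < β, g β ξ = tupleStream 1 side τ ξ}) :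
    α.cof.ord = α := by
  -- Diagonalize against `g`. If `cof α < α`, the limit points `β` of a cofinal set `A` of size `cof
  -- α` get different codes below `cof α`, through the least element of `A` above or equal to `β`.
  -- The stream that contradicts the guess at `β` at the coordinate coding `β` is then never guessed
  -- at a limit point of `A` above `cof α`.
  by_contra hne
  have hlt : α.cof.ord < α := lt_of_le_of_ne (Ordinal.ord_cof_le α) hne
  have hlim := isSuccLimit_of_aleph0_lt_cof hα
  obtain ⟨A, hA, hAc⟩ := Order.exists_cof_eq (Iio α)
  have hle : #A ≤ #(Iio α.cof.ord) := by
    rw [hAc, Ordinal.cof_Iio, ← Ordinal.lift_cof, Cardinal.mk_Iio_ordinal, Cardinal.card_ord]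
  obtain ⟨⟨e, he⟩⟩ := hle
  have hunb : ∀ ξ < α, ∃ ζ ∈ Subtype.val '' A, ξ < ζ ∧ ζ < α := by
    intro ξ hξ
    obtain ⟨ζ, h1, h2⟩ := hA ⟨Order.succ ξ, hlim.succ_lt hξ⟩
    exact ⟨ζ.1, ⟨ζ, h1, rfl⟩, (Order.lt_succ ξ).trans_le h2, ζ.2⟩
  have hmin : ∀ β : Iio α, ∃ a ∈ A, β ≤ a ∧ ∀ b ∈ A, β ≤ b → a ≤ b := by
    intro β
    obtain ⟨a, h1, h2⟩ := WellFounded.has_min (wellFounded_lt (α := Iio α)) {a | a ∈ A ∧ β ≤ a}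
      (hA β)
    exact ⟨a, h1.1, h1.2, fun b h3 h4 => not_lt.1 (h2 b ⟨h3, h4⟩)⟩
  choose n hnA hn1 hn2 using hmin
  have hinj : ∀ β β' : Iio α, IsLimPt (Subtype.val '' A) β'.1 → n β = n β' → ¬ β < β' := by
    intro β β' hl hnn hlt
    obtain ⟨_, ⟨a, ha, rfl⟩, h1, h2⟩ := hl.2 β.1 hlt
    have h3 : n β' ≤ a := hnn ▸ hn2 β a ha (le_of_lt h1)
    exact ((hn1 β').trans h3).not_gt h2
  have hclub := (clubIn_isLimPt hα hunb).inter hα (clubIn_Ioi hα hlt)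
  obtain ⟨β, ⟨hβα, hβg⟩, ⟨hβl, hβc⟩, -⟩ := (h fun _ => {ζ | ∃ β : Iio α,
    IsLimPt (Subtype.val '' A) β.1 ∧ (e ⟨n β, hnA β⟩).1 = ζ ∧ 0 ∉ (g β.1 ζ).col}).exists_mem hclub
  have hζ := hβg (e ⟨n ⟨β, hβα⟩, hnA _⟩).1 ((mem_Iio.1 (e ⟨n ⟨β, hβα⟩, hnA _⟩).2).trans hβc)
  set ζ := (e ⟨n ⟨β, hβα⟩, hnA _⟩).1 with hζdef
  have key : 0 ∈ (g β ζ).col ↔ ¬ 0 ∈ (g β ζ).col := by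
    have h1 : 0 ∈ (g β ζ).col ↔ ∃ β' : Iio α, IsLimPt (Subtype.val '' A) β'.1 ∧
        (e ⟨n β', hnA β'⟩).1 = ζ ∧ 0 ∉ (g β'.1 ζ).col := by
      rw [hζ]
      exact and_iff_right zero_lt_one
    rw [h1]
    constructor
    · rintro ⟨β', h2, h3, h4⟩
      have h5 : n β' = n ⟨β, hβα⟩ := Subtype.ext_iff.1 (he (Subtype.ext h3))
      have h6 : β' = ⟨β, hβα⟩ := le_antisymm (not_lt.1 (hinj _ _ h2 h5.symm))
        (not_lt.1 (hinj _ _ hβl h5))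
      rw [h6, h1] at h4
      exact h4
    · intro h2
      exact ⟨⟨β, hβα⟩, hβl, rfl, fun h3 => h2 (h1.1 h3)⟩
  tauto

theorem mk_Iio_lt_lift_cof {α θ : Ordinal.{u}} (hα : α.cof.ord = α) (hθ : θ < α) :
    #(Iio θ) < Cardinal.lift.{u + 1} α.cof :=
  mk_Iio_lt_of_lt_ord (hα.symm ▸ hθ)

theorem normTuple_normTuple (θ ζ : Ordinal.{u}) (s : Ordinal.{u} → Set Ordinal.{u}) :
    normTuple θ ζ (normTuple θ ζ s) = normTuple θ ζ s := by
  funext i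
  ext ξ
  exact ⟨fun h => ⟨h.1, h.2.1, h.2.2.2.2⟩, fun h => ⟨h.1, h.2.1, h⟩⟩

/-! ### Sealing: meeting a dense target on a whole level. -/

section

variable {κ : Cardinal.{u}} {C : Ordinal.{u} → Set Ordinal.{u}} {g : GuessSeq.{u}}

variable (C g) in
/-- `τ` is a tuple of nodes at height `ζ`. -/
def LevTuple (θ : Ordinal.{u}) (H : Ordinal.{u} → Set Ordinal.{u}) (ζ : Ordinal.{u})
    (τ : Ordinal.{u} → Set Ordinal.{u}) : Prop := ∀ i < θ, Lev C g ζ (H i) (τ i)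

variable (C g) in
/-- Some extension to height `ζ'` of the tuple `τ` of height `ζ` meets the target `U`. -/
def TargetReached (θ : Ordinal.{u}) (H : Ordinal.{u} → Set Ordinal.{u})
    (U : Ordinal.{u} → Set (Ordinal.{u} → Set Ordinal.{u})) (ζ : Ordinal.{u})
    (τ : Ordinal.{u} → Set Ordinal.{u}) (ζ' : Ordinal.{u}) : Prop :=
  ζ ≤ ζ' ∧ ∃ τ', LevTuple C g θ H ζ' τ' ∧ (∀ i < θ, AgreeBelow ζ (τ' i) (τ i)) ∧
    ∃ ζ'' ≤ ζ', normTuple θ ζ'' τ' ∈ U ζ''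

/-- Heights below which all tuples reach the target form a club. -/
theorem clubIn_targetReached (hκ : κ.IsInaccessible) {θ : Ordinal.{u}} (hθ : θ < κ.ord)
    {H : Ordinal.{u} → Set Ordinal.{u}} {U : Ordinal.{u} → Set (Ordinal.{u} → Set Ordinal.{u})}
    (hU : ∀ ζ < κ.ord, ∀ τ, LevTuple C g θ H ζ τ → ∃ ζ' < κ.ord, TargetReached C g θ H U ζ τ ζ') :
    ClubIn κ.ord {β | ∀ η < β, ∃ ζ < β, ∀ τ, LevTuple C g θ H η τ →
      ∃ ζ' ≤ ζ, TargetReached C g θ H U η τ ζ'} := by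
  have hcof : κ.ord.cof = κ := hκ.isRegular.cof_ord
  have hlim := Cardinal.isSuccLimit_ord hκ.aleph0_lt.le
  refine clubIn_closure (P := fun η ζ => ∀ τ, LevTuple C g θ H η τ →
      ∃ ζ' ≤ ζ, TargetReached C g θ H U η τ ζ') (by rw [hcof]; exact hκ.aleph0_lt) fun ξ hξ => ?_
  -- Up to agreement, tuples of height at most `ξ` are relations on `θ × ξ`, fewer than `κ` many, so
  -- regularity bounds the heights they need.
  let dec : Set (Iio θ × Iio ξ) → Ordinal.{u} → Set Ordinal.{u} := fun R i =>
    {x | ∃ (hi : i < θ) (hx : x < ξ), (⟨i, hi⟩, ⟨x, hx⟩) ∈ R}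
  have hf : ∀ x : Iio (Order.succ ξ) × Set (Iio θ × Iio ξ), ∃ ζ < κ.ord,
      LevTuple C g θ H x.1.1 (dec x.2) → TargetReached C g θ H U x.1.1 (dec x.2) ζ := by
    intro x
    by_cases h : LevTuple C g θ H x.1.1 (dec x.2)
    · obtain ⟨ζ, h1, h2⟩ := hU _ (lt_trans x.1.2 (hlim.succ_lt hξ)) _ h
      exact ⟨ζ, h1, fun _ => h2⟩
    · exact ⟨0, hlim.bot_lt, fun h' => absurd h' h⟩
  choose f hf1 hf2 using hf
  obtain ⟨ζ, hζ, hle⟩ := exists_lt_forall_le (α := κ.ord) (by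
    rw [hcof]
    exact hκ.mk_prod_lt (mk_Iio_lt_of_lt_ord (hlim.succ_lt hξ))
      (hκ.mk_set_lt (hκ.mk_prod_lt (mk_Iio_lt_of_lt_ord hθ) (mk_Iio_lt_of_lt_ord hξ)))) f hf1
  refine ⟨ζ, hζ, fun η hη => ⟨ζ, le_rfl, fun τ hτ => ?_⟩⟩
  set R : Set (Iio θ × Iio ξ) := {p | p.2.1 ∈ τ p.1.1} with hR
  have hag : ∀ i < θ, AgreeBelow η (dec R i) (τ i) := fun i hi x hx =>
    ⟨fun ⟨_, _, h⟩ => h, fun h => ⟨hi, hx.trans_le hη, h⟩⟩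
  have h1 : LevTuple C g θ H η (dec R) := fun i hi => (hτ i hi).congr (.refl _ _) (hag i hi).symm
  obtain ⟨h2, τ', h3, h4, h5⟩ := hf2 (⟨η, Order.lt_succ_iff.2 hη⟩, R) h1
  exact ⟨_, hle _, h2, τ', h3, fun i hi => (h4 i hi).trans (hag i hi), h5⟩

/-- Sealing: a dense target is met by all tuples of nodes of some height below `κ`. -/
theorem exists_forall_levTuple_target (hκ : κ.IsInaccessible) {S : Set Ordinal.{u}}
    (hS : S ⊆ uncountableCofBelow κ) (hS' : StationaryIn κ.ord S) (hC : IsCoherentClubSeq κ C)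
    (hP : ∀ B ⊆ Iio κ.ord, (∀ ξ < κ.ord, ∃ ζ ∈ B, ξ < ζ ∧ ζ < κ.ord) →
      StationaryIn κ.ord {α | α ∈ S ∧ IsLimPt (naccPts (C α) ∩ B) α})
    (hg : GuessesTuples κ S g) {θ : Ordinal.{u}} (hθ : θ < κ.ord)
    {H : Ordinal.{u} → Set Ordinal.{u}} {ε : Ordinal.{u}} (hε : ε < κ.ord)
    (hH : ∀ i < θ, ∀ j < θ, AgreeBelow ε (H i) (H j) → i = j)
    {U : Ordinal.{u} → Set (Ordinal.{u} → Set Ordinal.{u})}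
    (hU : ∀ ζ < κ.ord, ∀ τ, LevTuple C g θ H ζ τ → ∃ ζ' < κ.ord, TargetReached C g θ H U ζ τ ζ') :
    ∃ α < κ.ord, ∀ τ, LevTuple C g θ H α τ → ∃ ζ < α, normTuple θ ζ τ ∈ U ζ := by
  by_contra! hcon
  have hcof : ℵ₀ < κ.ord.cof := by rw [hκ.isRegular.cof_ord]; exact hκ.aleph0_lt
  have hlim := isSuccLimit_of_aleph0_lt_cof hcof
  have hD₂ := clubIn_targetReached hκ hθ hU
  set D₂ : Set Ordinal.{u} := {β | ∀ η < β, ∃ ζ < β, ∀ τ, LevTuple C g θ H η τ →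
      ∃ ζ' ≤ ζ, TargetReached C g θ H U η τ ζ'} with hD₂def
  -- The side information does not mention the tuple, so a single set `B` of correct points serves
  -- all tuples. The flag records `D₂`, so that membership in `B` can be read off from the guesses.
  set side : Ordinal.{u} → SideDatum.{u} := fun ξ =>
    ⟨θ, {i | i < θ ∧ ξ ∈ H i}, {τ | normTuple θ ξ τ = τ ∧ τ ∈ U ξ}, ξ ∈ D₂⟩ with hside
  obtain ⟨D₁, hD₁, hguess⟩ := hg θ hθ side fun ξ => ⟨rfl, fun i hi => hi.1, fun τ hτ => hτ.1⟩
  -- Guessing single subsets, with trivial side information, is used only for the regularity of `α`.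
  obtain ⟨D₃, hD₃, hreg⟩ := hg 1 (by simpa using hlim.succ_lt hlim.bot_lt) (fun _ => ⟨1, ∅, ∅, False⟩)
    fun ξ => ⟨rfl, empty_subset _, fun τ hτ => absurd hτ (notMem_empty _)⟩
  set B : Set Ordinal.{u} := {γ | γ < κ.ord ∧ (∀ ξ < γ, (g γ ξ).side = side ξ) ∧
    ∀ ξ < γ, ∃ ζ ∈ D₂, ξ < ζ ∧ ζ < γ} with hB
  have hD₂u : ∀ ξ < κ.ord, ∃ ζ ∈ D₂, ξ < ζ ∧ ζ < κ.ord := fun ξ hξ => hD₂.exists_gt hlim hξ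
  have hBu : ∀ ξ < κ.ord, ∃ ζ ∈ B, ξ < ζ ∧ ζ < κ.ord := by
    intro ξ hξ
    obtain ⟨α, hαS, ⟨⟨hα1, hα2⟩, hα3⟩, hακ⟩ := hS'.exists_mem
      ((hD₁.inter hcof (clubIn_isLimPt hcof hD₂u)).inter hcof (clubIn_Ioi hcof hξ))
    obtain ⟨β, ⟨hβα, hβ⟩, ⟨h1, h2⟩, -⟩ := (hguess α ⟨hαS, hα1⟩ hακ fun _ => ∅).exists_mem
      ((clubIn_isLimPt (hS hαS).2 hα2.2).inter (hS hαS).2 (clubIn_Ioi (hS hαS).2 hα3))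
    exact ⟨β, ⟨hβα.trans hακ, fun ξ hξ => by rw [hβ ξ hξ]; rfl, h1.2⟩, h2, hβα.trans hακ⟩
  obtain ⟨α, ⟨hαS, hαB⟩, ⟨⟨⟨hα1, hα3⟩, hαθ⟩, hαε⟩, hακ⟩ :=
    (hP B (fun γ hγ => hγ.1) hBu).exists_mem (((hD₁.inter hcof hD₃).inter hcof
      (clubIn_Ioi hcof hθ)).inter hcof (clubIn_Ioi hcof hε))
  have hαcof := (hS hαS).2
  have hαreg : α.cof.ord = α := ord_cof_eq_of_guesses hαcof (hreg α ⟨hαS, hα3⟩ hακ)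
  obtain ⟨τ, hτ, hτU⟩ := hcon α hακ
  have hG := hguess α ⟨hαS, hα1⟩ hακ τ
  have hidx : ∀ γ, (∀ ξ < γ, (g γ ξ).side = side ξ) → ∀ i < θ,
      AgreeBelow γ (guessIdx g γ i) (H i) := by
    intro γ hγ i hi ξ hξ
    change i ∈ (g γ ξ).side.idx ↔ _
    rw [hγ ξ hξ]
    exact and_iff_right hi
  have hlen : ∀ γ, 0 < γ → (∀ ξ < γ, (g γ ξ).side = side ξ) → guessLen g γ = θ := by
    intro γ h0 hγ
    rw [guessLen, hγ 0 h0]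
  have htup : ∀ β, (∀ ξ < β, g β ξ = tupleStream θ side τ ξ) → ∀ i < θ,
      AgreeBelow β (guessTuple g β i) (τ i) := by
    intro β hβ i hi ξ hξ
    change i ∈ (g β ξ).col ↔ _
    rw [hβ ξ hξ]
    exact and_iff_right hi
  -- Were failures of `τ i` cofinal in `α`, some limit `β > ε` of failures would carry a correct
  -- guess of `τ`. As `C β` agrees with `C α` below `β`, the node `τ i` would be omitted at `β`; the
  -- indices already differ below `ε`, so the uniqueness clause holds.
  have hdis : ∀ i : Iio θ, ∃ δ < α, ∀ γ ∈ naccPts (C α), δ < γ → Obeys C g γ (C α) (H i) (τ i) := by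
    rintro ⟨i, hi⟩
    by_contra! hc
    have hA : ∀ ξ < α, ∃ ζ ∈ {γ | γ ∈ naccPts (C α) ∧ ¬ Obeys C g γ (C α) (H i) (τ i)},
        ξ < ζ ∧ ζ < α := by
      intro ξ hξ
      obtain ⟨γ, h1, h2, h3⟩ := hc ξ hξ
      exact ⟨γ, ⟨h1, h3⟩, h2, hC.lt α hακ γ (mem_naccPts_iff.1 h1).1⟩
    obtain ⟨β, ⟨hβα, hβ⟩, ⟨hβl, hβε⟩, -⟩ := hG.exists_mem
      ((clubIn_isLimPt hαcof hA).inter hαcof (clubIn_Ioi hαcof hαε))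
    have hβs : ∀ ξ < β, (g β ξ).side = side ξ := fun ξ hξ => by rw [hβ ξ hξ]; rfl
    have hcoh := hC.coherent α hακ β hβα (hβl.mono fun γ hγ => (mem_naccPts_iff.1 hγ.1).1)
    refine ((lev_iff C g _ _ _).1 ((hτ i hi).mono hβα.le)).2 ((killed_iff C g _ _ _).2 ?_)
    rw [hlen β hβl.1 hβs]
    refine ⟨hβl.isSuccLimit, ⟨i, hi, hidx β hβs i hi, htup β hβ i hi⟩, fun j hj h => ?_, ?_⟩
    · obtain rfl := hH j hj i hi (((hidx β hβs j hj).symm.trans h).mono (le_of_lt hβε))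
      exact htup β hβ j hj
    · rintro ⟨δ, hδ, h⟩
      obtain ⟨γ, ⟨h1, h2⟩, h3, h4⟩ := hβl.2 δ hδ
      exact h2 ((h γ h4 ((agreeBelow_naccPts hcoh γ h4).1 h1) h3).congr
        (hcoh.symm.mono h4.le) (.refl _ _) (.refl _ _))
  choose δ' hδ'α hδ' using hdis
  obtain ⟨δ, hδα, hδ⟩ := exists_lt_forall_le (mk_Iio_lt_lift_cof hαreg hαθ) δ' hδ'α
  have hob : ∀ i < θ, ∀ γ ∈ naccPts (C α), δ < γ → Obeys C g γ (C α) (H i) (τ i) :=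
    fun i hi γ hγ h => hδ' ⟨i, hi⟩ γ hγ ((hδ _).trans_lt h)
  obtain ⟨β, ⟨hβα, hβ⟩, ⟨⟨hβl, hβε⟩, hβδ⟩, -⟩ := hG.exists_mem
    (((clubIn_isLimPt hαcof hαB.2).inter hαcof (clubIn_Ioi hαcof hαε)).inter hαcof
      (clubIn_Ioi hαcof hδα))
  have hβl' : IsLimPt (C α) β := hβl.mono fun γ hγ => (mem_naccPts_iff.1 hγ.1).1
  have hβC : β ∈ C α := hC.closed α hακ β hβα hβl'
  -- Minimality of `γ` makes `β` the supremum of the matching points before `γ`, so the instruction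
  -- at `γ` consults exactly the guess at `β`, which is `τ`.
  obtain ⟨γ, ⟨⟨hγn, hγB⟩, hβγ⟩, hγmin⟩ := WellFounded.has_min (wellFounded_lt (α := Ordinal.{u}))
    {γ | γ ∈ naccPts (C α) ∩ B ∧ β < γ} (by
      obtain ⟨ζ, h1, h2, h3⟩ := hαB.2 β hβα
      exact ⟨ζ, h1, h2⟩)
  have hγα : γ < α := hC.lt α hακ γ (mem_naccPts_iff.1 hγn).1
  have hβn : β ∉ naccPts (C α) := fun h => (mem_naccPts_iff.1 h).2 hβl'
  have hγ0 : 0 < γ := (zero_le).trans_lt hβγ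
  set c : Set Ordinal.{u} := C α ∩ Iio γ with hc
  have hM : sSup (matchingPts g c γ) = β := by
    rw [hc, matchingPts_inter_Iio]
    apply le_antisymm
    · refine csSup_le' fun γ' hγ' => ?_
      by_contra! hlt
      refine hγmin γ' ⟨⟨hγ'.1, (hγ'.2.1.trans hγB.1), fun ξ hξ => ?_, fun ξ hξ => ?_⟩, hlt⟩ hγ'.2.1
      · rw [hγ'.2.2.1 ξ hξ]
        exact hγB.2.1 ξ (hξ.trans hγ'.2.1)
      · obtain ⟨ζ, h1, h2, h3⟩ := hγ'.2.2.2 ξ hξ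
        rw [hγ'.2.2.1 ζ h2, hγB.2.1 ζ (h2.trans hγ'.2.1)] at h3
        exact ⟨ζ, h3, h1, h2⟩
    · refine le_of_forall_lt fun ξ hξ => ?_
      obtain ⟨γ', ⟨h1, h2⟩, h3, h4⟩ := hβl.2 ξ hξ
      have h5 := h4.trans hβγ
      refine h3.trans_le (le_csSup ⟨γ, fun x hx => le_of_lt hx.2.1⟩ ⟨h1, h5, fun η hη => ?_,
        fun η hη => ?_⟩)
      · rw [h2.2.1 η hη, hγB.2.1 η (hη.trans h5)]
      · obtain ⟨ζ, h6, h7, h8⟩ := h2.2.2 η hη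
        refine ⟨ζ, h7, h8, ?_⟩
        rw [h2.2.1 ζ h8]
        exact h6
  have hlenγ := hlen γ hγ0 hγB.2.1
  set p := sSup (C α ∩ Iio γ) with hp
  have hclosed : ∀ ξ ≤ γ, IsLimPt (C α) ξ → ξ ∈ C α := fun ξ hξ =>
    hC.closed α hακ ξ (hξ.trans_lt hγα)
  have hpC : p ∈ C α := sSup_inter_Iio_mem hclosed hβC hβγ
  have hpγ : p < γ := sSup_inter_Iio_lt hγ0 (mem_naccPts_iff.1 hγn).2
  have hple : ∀ η ∈ C α, η < γ → η ≤ p := fun η h1 h2 =>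
    le_csSup (bddAbove_inter_Iio (C α) γ) ⟨h1, h2⟩
  have hβp : β ≤ p := hple β hβC hβγ
  have hcag : ∀ η ≤ γ, AgreeBelow η c (C α) := fun η hη => .inter_Iio _ hη
  have hcn : ∀ η ∈ naccPts c, η ∈ naccPts (C α) ∧ η < γ := fun η hη => by
    rw [hc, naccPts_inter_Iio] at hη
    exact hη
  -- Extend `τ` from height `p`, the last point of `C α` before `γ`. A point of `D₂` between `p` and
  -- `γ` ensures that the target is reached below `γ`. Obedience is inherited from `τ`, since all
  -- earlier points of `c` are at most `p`.
  have hgood : ∃ s, Good C g γ c s := by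
    obtain ⟨d, hd, hpd, hdγ⟩ := hγB.2.2 p hpγ
    obtain ⟨ζ, hζ, hreach⟩ := hd p hpd
    obtain ⟨ζ', hζ', hpζ', τ', h1, h2, ζ'', h3, h4⟩ := hreach τ fun i hi =>
      (hτ i hi).mono (hpγ.trans hγα).le
    have hζ'γ : ζ' < γ := hζ'.trans_lt (hζ.trans hdγ)
    choose! s hs1 hs2 using fun i (hi : i < θ) =>
      exists_lev_extension (g := g) hC (hγα.trans hακ) hζ'γ.le (h1 i hi)
    have hsp : ∀ i < θ, AgreeBelow p (s i) (τ i) := fun i hi =>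
      ((hs2 i hi).mono hpζ').trans (h2 i hi)
    refine ⟨s, (good_iff C g _ _ _).2 ?_⟩
    rw [hM, hlenγ]
    refine ⟨fun i hi => ⟨?_, ?_, fun η hη hηn hβη => ?_⟩, ζ'', h3.trans_lt hζ'γ, ?_⟩
    · exact ((hsp i hi).mono hβp).trans (htup β hβ i hi).symm
    · exact (hs1 i hi).congr (hidx γ hγB.2.1 i hi).symm (.refl _ _)
    · have hηn' := (hcn η hηn).1
      exact (hob i hi η hηn' (lt_trans hβδ hβη)).congr (hcag η hη.le).symm
        ((hidx γ hγB.2.1 i hi).symm.mono hη.le)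
        ((hsp i hi).symm.mono (hple η (mem_naccPts_iff.1 hηn').1 hη))
    · rw [hγB.2.1 ζ'' (h3.trans_lt hζ'γ)]
      refine ⟨normTuple_normTuple _ _ _, ?_⟩
      rwa [normTuple_congr fun i hi => (hs2 i hi).mono h3]
  have hgood' := Classical.epsilon_spec hgood
  set s := Classical.epsilon (Good C g γ c) with hs
  obtain ⟨hs1, ζ, hζγ, hζ⟩ := (good_iff C g _ _ _).1 hgood'
  rw [hM, hlenγ] at hs1
  rw [hlenγ, hγB.2.1 ζ hζγ] at hζ
  -- The chosen `s` need not be the tuple just built, but it starts from `τ` at `β` and obeys the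
  -- same instructions up to `p`.
  have hsp : ∀ i < θ, AgreeBelow p (s i) (τ i) := by
    intro i hi
    refine agreeBelow_of_obeys (C := C) (g := g) (H := H i) (c := C α)
      (fun ξ hξ => hclosed ξ (hξ.trans hpγ.le)) hβC hpC hβp
      ((hs1 i hi).1.trans (htup β hβ i hi)) (fun η hηn hβη hηp => ?_)
      (fun η hηn hβη hηp => hob i hi η hηn (lt_trans hβδ hβη))
    have hηγ := hηp.trans_lt hpγ
    refine ((hs1 i hi).2.2 η hηγ ?_ hβη).congr (hcag η hηγ.le)
      ((hidx γ hγB.2.1 i hi).mono hηγ.le) (.refl _ _)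
    rw [hc, naccPts_inter_Iio]
    exact ⟨hηn, hηγ⟩
  have hsγ : ∀ i < θ, AgreeBelow γ (τ i) (s i) := by
    intro i hi
    have h := (obeys_iff C g _ _ _ _).1 (hob i hi γ hγn (lt_trans hβδ hβγ))
    have hex : Good C g γ c s ∧ ∃ j < guessLen g γ, AgreeBelow γ (guessIdx g γ j) (H i ∩ Iio γ) ∧
        AgreeBelow p (s j) (τ i ∩ Iio p) :=
      ⟨hgood', i, hlenγ ▸ hi, (hidx γ hγB.2.1 i hi).trans (AgreeBelow.inter_Iio _ le_rfl).symm,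
        (hsp i hi).trans (AgreeBelow.inter_Iio _ le_rfl).symm⟩
    rw [prescribed, dif_pos hex] at h
    obtain ⟨h1, h2, -⟩ := hex.2.choose_spec
    -- The coordinate picked by `choose` must be `i`, because different indices are separated below
    -- `ε < γ`.
    have h1' := h1.trans_eq hlenγ
    have := hH _ h1' i hi ((((hidx γ hγB.2.1 _ h1').symm.trans h2).trans
      (.inter_Iio _ le_rfl)).mono (lt_trans hβε hβγ).le)
    rwa [this] at h
  refine hτU ζ (hζγ.trans hγα) ?_
  rw [normTuple_congr fun i hi => (hsγ i hi).mono hζγ.le]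
  exact hζ.2

end

/-! ### Heights in trees -/

section Height

variable {X : Type v} [PartialOrder X] {h : X → Ordinal.{u}}

/-- `h` is a height function on the tree `X`. -/
structure IsHeight (h : X → Ordinal.{u}) : Prop where
  strictMono : StrictMono h
  exists_lt : ∀ x, ∀ ξ < h x, ∃ y < x, h y = ξ
  le_of_le : ∀ x y z, y ≤ x → z ≤ x → h y ≤ h z → y ≤ z

theorem eq_of_Iio_orderIso {α β : Ordinal.{u}} (e : Iio α ≃o Iio β) : α = β := by
  have := Ordinal.type_eq.2 ⟨e.toRelIsoLT⟩
  simpa using this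

theorem IsHeight.exists_orderIso (hh : IsHeight h) (x : X) : Nonempty (Iio x ≃o Iio (h x)) := by
  let f : Iio x ↪o Iio (h x) :=
    OrderEmbedding.ofMapLEIff (fun y => ⟨h y.1, hh.strictMono y.2⟩) fun y z =>
      ⟨fun hle => hh.le_of_le x y.1 z.1 (le_of_lt y.2) (le_of_lt z.2) hle,
        fun hle => hh.strictMono.monotone hle⟩
  refine ⟨RelIso.ofSurjective f fun ξ => ?_⟩
  obtain ⟨y, h1, h2⟩ := hh.exists_lt x ξ.1 ξ.2
  exact ⟨⟨y, h1⟩, Subtype.ext h2⟩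

/-- The height function identifies the predecessors of `x` with `Iio (h x)`, and isomorphic ordinals
are equal. -/
theorem IsHeight.mem_treeLevel_iff (hh : IsHeight h) {x : X} {α : Ordinal.{u}} :
    x ∈ treeLevel X α ↔ h x = α := by
  obtain ⟨e⟩ := hh.exists_orderIso x
  constructor
  · rintro ⟨e'⟩
    exact eq_of_Iio_orderIso (e.symm.trans e')
  · rintro rfl
    exact ⟨e⟩

theorem IsHeight.eq_of_le (hh : IsHeight h) {x y z : X} (hy : y ≤ x) (hz : z ≤ x)
    (he : h y = h z) : y = z :=
  le_antisymm (hh.le_of_le x y z hy hz he.le) (hh.le_of_le x z y hz hy he.ge)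

theorem IsHeight.isKappaTree (hh : IsHeight h) {κ : Cardinal.{u}} (hlt : ∀ x, h x < κ.ord)
    (hne : ∀ α < κ.ord, ∃ x, h x = α)
    (hsmall : ∀ α < κ.ord, Cardinal.lift.{u} #{x | h x = α} < Cardinal.lift.{v} κ) :
    IsKappaTree X κ := by
  have hlev : ∀ α, treeLevel X α = {x | h x = α} := fun α => by
    ext x
    exact hh.mem_treeLevel_iff
  refine ⟨fun x => ?_, fun α hα => ?_, fun α hα => ?_, ?_⟩
  · obtain ⟨e⟩ := hh.exists_orderIso x
    exact e.toRelIsoLT.toRelEmbedding.isWellOrder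
  · rw [hlev]
    exact hne α hα
  · rw [hlev]
    exact hsmall α hα
  · rw [hlev]
    exact eq_empty_of_forall_notMem fun x hx => (hlt x).ne hx

end Height

/-! ### Binary sequences as sets of ordinals -/

namespace OrdSeq

/-- The set of indices where the entry is `1 = {∅}`. -/
def supp (s : OrdSeq.{u}) : Set Ordinal.{u} := {ξ | ∃ h : ξ < s.len, s.val ⟨ξ, h⟩ = {∅}}

/-- All entries belong to `2 = {∅, {∅}}`. -/
def IsBin (s : OrdSeq.{u}) : Prop := ∀ i, s.val i = ∅ ∨ s.val i = {∅}

open Classical in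
/-- The characteristic function of a set of ordinals, as a sequence of length `α`. -/
noncomputable def ofSet (α : Ordinal.{u}) (t : Set Ordinal.{u}) : OrdSeq.{u} :=
  ⟨α, fun ξ => if ξ.1 ∈ t then {∅} else ∅⟩

theorem singleton_empty_ne_empty : ({∅} : ZFSet.{u}) ≠ ∅ := by
  intro h
  have h1 : (∅ : ZFSet.{u}) ∈ ({∅} : ZFSet.{u}) := ZFSet.mem_singleton.2 rfl
  rw [h] at h1
  exact ZFSet.notMem_empty ∅ h1

theorem ofSet_isBin (α : Ordinal.{u}) (t : Set Ordinal.{u}) : (ofSet α t).IsBin := by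
  intro i
  by_cases h : i.1 ∈ t
  · exact Or.inr (if_pos h)
  · exact Or.inl (if_neg h)

theorem supp_ofSet (α : Ordinal.{u}) (t : Set Ordinal.{u}) : AgreeBelow α (ofSet α t).supp t := by
  intro ξ hξ
  constructor
  · rintro ⟨h1, h2⟩
    by_contra h
    exact singleton_empty_ne_empty (h2.symm.trans (if_neg h))
  · exact fun h => ⟨hξ, if_pos h⟩

theorem IsBin.le_iff {s t : OrdSeq.{u}} (hs : s.IsBin) (ht : t.IsBin) :
    s ≤ t ↔ s.len ≤ t.len ∧ AgreeBelow s.len s.supp t.supp := by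
  constructor
  · rintro ⟨h, e⟩
    refine ⟨h, fun ξ hξ => ⟨fun ⟨h1, h2⟩ => ⟨h1.trans_le h, (e ξ h1) ▸ h2⟩, fun ⟨h1, h2⟩ =>
      ⟨hξ, (e ξ hξ).trans h2⟩⟩⟩
  · rintro ⟨h, e⟩
    refine ⟨h, fun ξ hξ => ?_⟩
    obtain h1 | h1 := ht ⟨ξ, hξ.trans_le h⟩
    · rw [h1]
      refine (hs ⟨ξ, hξ⟩).resolve_right fun h2 => ?_
      obtain ⟨h3, h4⟩ := (e ξ hξ).1 ⟨hξ, h2⟩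
      exact singleton_empty_ne_empty (h4.symm.trans h1)
    · rw [h1]
      exact ((e ξ hξ).2 ⟨_, h1⟩).2

theorem IsBin.eq_of {s t : OrdSeq.{u}} (hs : s.IsBin) (ht : t.IsBin) (hl : s.len = t.len)
    (h : AgreeBelow s.len s.supp t.supp) : s = t :=
  le_antisymm ((hs.le_iff ht).2 ⟨hl.le, h⟩) ((ht.le_iff hs).2 ⟨hl.ge, hl ▸ h.symm⟩)

theorem len_lt_of_lt {s t : OrdSeq.{u}} (h : s < t) : s.len < t.len := by
  obtain ⟨⟨h1, h2⟩, h3⟩ := lt_iff_le_not_ge.1 h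
  refine lt_of_le_of_ne h1 fun he => h3 ⟨he.ge, fun i hi => (h2 i (he ▸ hi)).symm⟩

theorem restrict_le (t : OrdSeq.{u}) (β : Ordinal.{u}) : t.restrict β ≤ t :=
  ⟨min_le_left _ _, fun _ _ => rfl⟩

theorem len_restrict (t : OrdSeq.{u}) {β : Ordinal.{u}} (h : β ≤ t.len) :
    (t.restrict β).len = β := min_eq_right h

theorem le_of_le_of_le {r s t : OrdSeq.{u}} (hr : r ≤ t) (hs : s ≤ t) (h : r.len ≤ s.len) :
    r ≤ s := by
  obtain ⟨h1, h2⟩ := hr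
  obtain ⟨h3, h4⟩ := hs
  exact ⟨h, fun i hi => (h2 i hi).trans (h4 i (hi.trans_le h)).symm⟩

end OrdSeq

theorem IsStreamlined.isHeight {κ : Cardinal.{u}} {T : Set OrdSeq.{u}} (hT : IsStreamlined κ T) :
    IsHeight (fun x : T => x.1.len) := by
  refine ⟨fun x y hxy => OrdSeq.len_lt_of_lt hxy, fun x ξ hξ => ?_, fun x y z hy hz h =>
    OrdSeq.le_of_le_of_le (t := x.1) hy hz h⟩
  refine ⟨⟨x.1.restrict ξ, hT.restrict_mem x.1 x.2 ξ (hξ.trans (hT.len_lt x.1 x.2))⟩, ?_,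
    x.1.len_restrict hξ.le⟩
  refine lt_of_le_of_ne (x.1.restrict_le ξ) fun h => hξ.ne ?_
  rw [← x.1.len_restrict hξ.le]
  exact congrArg (fun y : T => y.1.len) h

/-! ### The trees -/

section Trees

variable (κ : Cardinal.{u}) (C : Ordinal.{u} → Set Ordinal.{u}) (g : GuessSeq.{u})

/-- The streamlined tree with index `H`. -/
def indexedTree (H : Set Ordinal.{u}) : Set OrdSeq.{u} :=
  {s | s.len < κ.ord ∧ s.IsBin ∧ Lev C g s.len H s.supp}

variable {κ C g} {H : Set Ordinal.{u}}

theorem ofSet_mem_indexedTree {α : Ordinal.{u}} (hα : α < κ.ord) {t : Set Ordinal.{u}} :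
    OrdSeq.ofSet α t ∈ indexedTree κ C g H ↔ Lev C g α H t :=
  ⟨fun h => h.2.2.congr (.refl _ _) (OrdSeq.supp_ofSet α t), fun h =>
    ⟨hα, OrdSeq.ofSet_isBin α t, h.congr (.refl _ _) (OrdSeq.supp_ofSet α t).symm⟩⟩

theorem restrict_mem_indexedTree {s : OrdSeq.{u}} (hs : s ∈ indexedTree κ C g H)
    (β : Ordinal.{u}) : s.restrict β ∈ indexedTree κ C g H := by
  have hb : (s.restrict β).IsBin := fun i => hs.2.1 _
  have hle := (hb.le_iff hs.2.1).1 (s.restrict_le β)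
  exact ⟨hle.1.trans_lt hs.1, hb, (hs.2.2.mono hle.1).congr (.refl _ _) hle.2.symm⟩

theorem le_iff_of_mem_indexedTree {H' : Set Ordinal.{u}} {s t : OrdSeq.{u}}
    (hs : s ∈ indexedTree κ C g H) (ht : t ∈ indexedTree κ C g H') :
    s ≤ t ↔ s.len ≤ t.len ∧ AgreeBelow s.len s.supp t.supp := hs.2.1.le_iff ht.2.1

variable (hκ : κ.IsInaccessible) (hC : IsCoherentClubSeq κ C)
include hκ hC

omit hκ in
theorem exists_mem_indexedTree_gt {s : OrdSeq.{u}} (hs : s ∈ indexedTree κ C g H)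
    {α : Ordinal.{u}} (hα : α < κ.ord) (hlt : s.len < α) :
    ∃ t ∈ indexedTree κ C g H, t.len = α ∧ s < t := by
  obtain ⟨t, h1, h2⟩ := exists_lev_extension hC hα hlt.le hs.2.2
  have hm := (ofSet_mem_indexedTree hα).2 h1
  refine ⟨_, hm, rfl, lt_of_le_of_ne ((le_iff_of_mem_indexedTree hs hm).2 ⟨hlt.le, ?_⟩) ?_⟩
  · exact h2.symm.trans ((OrdSeq.supp_ofSet α t).symm.mono hlt.le)
  · exact fun h => hlt.ne (congrArg OrdSeq.len h)

theorem indexedTree_isStreamlined : IsStreamlined κ (indexedTree κ C g H) where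
  len_lt t ht := ht.1
  val_mem t ht i := by
    have hlim := Cardinal.isSuccLimit_ord hκ.aleph0_lt.le
    obtain h | h := ht.2.1 i <;> rw [h]
    · simpa using toZFSet_mem_HSet (κ := κ) hlim.bot_lt
    · have h1 : (1 : Ordinal.{u}) < κ.ord := by simpa using hlim.succ_lt hlim.bot_lt
      have := toZFSet_mem_HSet h1
      rwa [← zero_add (1 : Ordinal.{u}), Ordinal.toZFSet_add_one, Ordinal.toZFSet_zero] at this
  restrict_mem t ht α _ := restrict_mem_indexedTree ht α
  nonempty α hα := by
    obtain ⟨t, h1, -⟩ := exists_lev_extension hC hα (zero_le) (lev_zero (C := C) (g := g) H ∅)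
    exact ⟨_, (ofSet_mem_indexedTree hα).2 h1, rfl⟩
  small α hα := by
    refine lt_of_le_of_lt (Cardinal.mk_le_of_injective (β := Set (Iio α))
      (f := fun s => {ξ | ξ.1 ∈ s.1.supp}) ?_) (hκ.mk_set_lt (mk_Iio_lt_of_lt_ord hα))
    rintro ⟨s, hs, rfl⟩ ⟨t, ht, hl⟩ h
    exact Subtype.ext (hs.2.1.eq_of ht.2.1 hl.symm fun ξ hξ => Set.ext_iff.1 h ⟨ξ, hξ⟩)

omit hκ hC in
theorem indexedTree_isBinary : IsBinary (indexedTree κ C g H) := fun _ ht => ht.2.1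

theorem indexedTree_isNormalTree : IsNormalTree (indexedTree κ C g H) κ := by
  have hh := (indexedTree_isStreamlined (g := g) (H := H) hκ hC).isHeight
  intro α hα β hβ x hx
  rw [hh.mem_treeLevel_iff] at hx
  obtain ⟨t, h1, h2, h3⟩ := exists_mem_indexedTree_gt hC x.2 hα (hx.trans_lt hβ)
  exact ⟨⟨t, h1⟩, hh.mem_treeLevel_iff.2 h2, h3⟩

omit hC in
/-- Both immediate successors of a node. -/
theorem exists_two_successors {s : OrdSeq.{u}} (hs : s ∈ indexedTree κ C g H) :
    ∃ t ∈ indexedTree κ C g H, ∃ t' ∈ indexedTree κ C g H, t ≠ t' ∧ t.len = Order.succ s.len ∧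
      t'.len = Order.succ s.len ∧ s < t ∧ s < t' := by
  have hlim := Cardinal.isSuccLimit_ord hκ.aleph0_lt.le
  have hlt := Order.lt_succ s.len
  have key : ∀ r : Set Ordinal.{u}, AgreeBelow s.len s.supp r →
      OrdSeq.ofSet (Order.succ s.len) r ∈ indexedTree κ C g H ∧
      s < OrdSeq.ofSet (Order.succ s.len) r := by
    intro r hr
    have hm : OrdSeq.ofSet (Order.succ s.len) r ∈ indexedTree κ C g H :=
      (ofSet_mem_indexedTree (hlim.succ_lt hs.1)).2 (hs.2.2.congr (.refl _ _) hr).succ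
    refine ⟨hm, lt_of_le_of_ne ((le_iff_of_mem_indexedTree hs hm).2 ⟨hlt.le, ?_⟩) ?_⟩
    · exact hr.trans ((OrdSeq.supp_ofSet _ r).symm.mono hlt.le)
    · exact fun h => hlt.ne (congrArg OrdSeq.len h)
  have h1 := key (s.supp \ {s.len}) fun ξ hξ => by simp [hξ.ne]
  have h2 := key (insert s.len s.supp) fun ξ hξ => by simp [hξ.ne]
  refine ⟨_, h1.1, _, h2.1, fun h => ?_, rfl, rfl, h1.2, h2.2⟩
  have := (OrdSeq.supp_ofSet _ _ _ hlt).2 (mem_insert s.len s.supp)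
  rw [← h] at this
  exact ((OrdSeq.supp_ofSet _ _ _ hlt).1 this).2 rfl

theorem indexedTree_isSplittingTree : IsSplittingTree (indexedTree κ C g H) := by
  have hh := (indexedTree_isStreamlined (g := g) (H := H) hκ hC).isHeight
  intro x
  obtain ⟨t, ht, t', ht', hne, hl, hl', hlt, hlt'⟩ := exists_two_successors hκ x.2
  have key : ∀ y : indexedTree κ C g H, y.1.len = Order.succ x.1.len → x < y → x ⋖ y :=
    fun y hy hxy => ⟨hxy, fun z h1 h2 => by
      have h3 := hh.strictMono h1
      have h4 := hh.strictMono h2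
      simp only [hy] at h4
      exact h3.not_ge (Order.lt_succ_iff.1 h4)⟩
  exact ⟨⟨t, ht⟩, ⟨t', ht'⟩, fun h => hne (Subtype.ext_iff.1 h), key _ hl hlt, key _ hl' hlt'⟩

/-- The union of a vanishing `α`-branch lies in all earlier levels, so it is missing from level `α`
only because it is `Killed`, and `Killed.unique` applies. -/
theorem indexedTree_isFullTree : IsFullTree (indexedTree κ C g H) κ := by
  have hh := (indexedTree_isStreamlined (g := g) (H := H) hκ hC).isHeight
  intro α hα hl
  have key : ∀ B : Set (indexedTree κ C g H), IsBranchOf α B → IsVanishing B →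
      ∃ t, Killed C g α H t ∧ ∀ x, x ∈ B ↔ x.1.len < α ∧ AgreeBelow x.1.len x.1.supp t := by
    rintro B ⟨hchain, hB1, hB2⟩ hvan
    set t : Set Ordinal.{u} := {ξ | ∃ x ∈ B, ξ ∈ x.1.supp} with ht
    have hlen : ∀ x ∈ B, x.1.len < α := fun x hx => by
      obtain ⟨β, hβ, h⟩ := hB1 x hx
      exact (hh.mem_treeLevel_iff.1 h).trans_lt hβ
    have hag : ∀ x ∈ B, AgreeBelow x.1.len x.1.supp t := by
      intro x hx ξ hξ
      refine ⟨fun h => ⟨x, hx, h⟩, ?_⟩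
      rintro ⟨y, hy, h⟩
      obtain hle | hle := hchain.total hx hy
      · exact (((le_iff_of_mem_indexedTree x.2 y.2).1 hle).2 ξ hξ).2 h
      · exact (((le_iff_of_mem_indexedTree y.2 x.2).1 hle).2 ξ h.1).1 h
    have hex : ∀ β < α, ∃ x ∈ B, x.1.len = β := fun β hβ => by
      obtain ⟨x, h1, h2⟩ := hB2 β hβ
      exact ⟨x, h1, hh.mem_treeLevel_iff.1 h2⟩
    refine ⟨t, ?_, fun x => ⟨fun hx => ⟨hlen x hx, hag x hx⟩, ?_⟩⟩
    · by_contra hk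
      have hlev : Lev C g α H t := (lev_iff C g _ _ _).2 ⟨fun β hβ => by
        obtain ⟨x, hx, rfl⟩ := hex β hβ
        exact x.2.2.2.congr (.refl _ _) (hag x hx), hk⟩
      have hm := (ofSet_mem_indexedTree hα).2 hlev
      refine hvan ⟨⟨_, hm⟩, fun x hx => (le_iff_of_mem_indexedTree x.2 hm).2
        ⟨(hlen x hx).le, (hag x hx).trans ((OrdSeq.supp_ofSet α t).symm.mono (hlen x hx).le)⟩⟩
    · rintro ⟨h1, h2⟩
      obtain ⟨y, hy, hyx⟩ := hex x.1.len h1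
      have : y = x := Subtype.ext (y.2.2.1.eq_of x.2.2.1 hyx
        ((hag y hy).trans (hyx.symm ▸ h2.symm)))
      exact this ▸ hy
  intro B B' hB hv hB' hv'
  obtain ⟨t, h1, h2⟩ := key B hB hv
  obtain ⟨t', h1', h2'⟩ := key B' hB' hv'
  have htt := h1.unique h1'
  ext x
  rw [h2, h2']
  exact and_congr_right fun hx => ⟨fun h => h.trans (htt.mono hx.le),
    fun h => h.trans (htt.symm.mono hx.le)⟩

end Trees

/-! ### Families of trees -/

section Family

/-- The assumptions under which the trees are constructed. -/
structure TreeSetting (κ : Cardinal.{u}) (S : Set Ordinal.{u}) (C : Ordinal.{u} → Set Ordinal.{u})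
    (g : GuessSeq.{u}) : Prop where
  inaccessible : κ.IsInaccessible
  subset : S ⊆ uncountableCofBelow κ
  stationary : StationaryIn κ.ord S
  coherent : IsCoherentClubSeq κ C
  hits : ∀ B ⊆ Iio κ.ord, (∀ ξ < κ.ord, ∃ ζ ∈ B, ξ < ζ ∧ ζ < κ.ord) →
    StationaryIn κ.ord {α | α ∈ S ∧ IsLimPt (naccPts (C α) ∩ B) α}
  guesses : GuessesTuples κ S g

variable {κ : Cardinal.{u}} {S : Set Ordinal.{u}} {C : Ordinal.{u} → Set Ordinal.{u}}
  {g : GuessSeq.{u}} (hs : TreeSetting κ S C g)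
include hs

/-- Sealing for families of nodes indexed by a small type. -/
theorem TreeSetting.exists_forall_target {ι : Type (u + 1)}
    (hι : #ι < Cardinal.lift.{u + 1} κ) {H : ι → Set Ordinal.{u}}
    (hH : ∀ i j, AgreeBelow κ.ord (H i) (H j) → i = j)
    {U : Ordinal.{u} → Set (ι → Set Ordinal.{u})}
    (hUc : ∀ ζ, ∀ σ σ' : ι → Set Ordinal.{u}, (∀ i, AgreeBelow ζ (σ i) (σ' i)) → σ ∈ U ζ → σ' ∈ U ζ)
    (hU : ∀ ζ < κ.ord, ∀ σ : ι → Set Ordinal.{u}, (∀ i, Lev C g ζ (H i) (σ i)) →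
      ∃ ζ' < κ.ord, ζ ≤ ζ' ∧ ∃ σ' : ι → Set Ordinal.{u},
      (∀ i, Lev C g ζ' (H i) (σ' i)) ∧ (∀ i, AgreeBelow ζ (σ' i) (σ i)) ∧
      ∃ ζ'' ≤ ζ', σ' ∈ U ζ'') :
    ∃ α < κ.ord, ∀ σ : ι → Set Ordinal.{u}, (∀ i, Lev C g α (H i) (σ i)) → ∃ ζ < α, σ ∈ U ζ := by
  have hκ := hs.inaccessible
  have hlim := Cardinal.isSuccLimit_ord hκ.aleph0_lt.le
  obtain ⟨c, hc, hιc⟩ := Cardinal.lt_lift_iff.1 hι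
  have hθ : c.ord < κ.ord := Cardinal.ord_lt_ord.2 hc
  obtain ⟨e⟩ : Nonempty (Iio c.ord ≃ ι) := by
    rw [← Cardinal.eq, Cardinal.mk_Iio_ordinal, Cardinal.card_ord, hιc]
  have hdiff : ∀ p : ι × ι, ∃ ξ < κ.ord, p.1 ≠ p.2 → ¬ (ξ ∈ H p.1 ↔ ξ ∈ H p.2) := by
    rintro ⟨i, j⟩
    by_cases hij : i = j
    · exact ⟨0, hlim.bot_lt, fun h => absurd hij h⟩
    · have := mt (hH i j) hij
      unfold AgreeBelow at this
      push Not at this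
      obtain ⟨ξ, h1, h2⟩ := this
      refine ⟨ξ, h1, fun _ => ?_⟩
      tauto
  choose d hd1 hd2 using hdiff
  -- Fewer than `κ` pairs of indices are to be separated, so by regularity one bound below `κ`
  -- works. Its successor is used later because `d` may attain `ε`.
  obtain ⟨ε, hε, hdε⟩ := exists_lt_forall_le (α := κ.ord) (by
    rw [hκ.isRegular.cof_ord]
    exact hκ.mk_prod_lt hι hι) d hd1
  classical
  let ext : (ι → Set Ordinal.{u}) → Ordinal.{u} → Set Ordinal.{u} := fun σ i =>
    if h : i < c.ord then σ (e ⟨i, h⟩) else ∅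
  have hext : ∀ σ i (hi : i < c.ord), ext σ i = σ (e ⟨i, hi⟩) := fun σ i hi => dif_pos hi
  have hexts : ∀ σ j, ext σ (e.symm j).1 = σ j := fun σ j =>
    (hext σ _ (e.symm j).2).trans (congrArg σ (e.apply_symm_apply j))
  set U' : Ordinal.{u} → Set (Ordinal.{u} → Set Ordinal.{u}) := fun ζ =>
    {τ | (fun j => τ (e.symm j).1) ∈ U ζ} with hU'
  have hnorm : ∀ ζ τ, normTuple c.ord ζ τ ∈ U' ζ ↔ (fun j => τ (e.symm j).1) ∈ U ζ := by
    intro ζ τ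
    have hag : ∀ j, AgreeBelow ζ (normTuple c.ord ζ τ (e.symm j).1) (τ (e.symm j).1) :=
      fun j ξ hξ => ⟨fun h => h.2.2, fun h => ⟨(e.symm j).2, hξ, h⟩⟩
    exact ⟨hUc ζ _ _ hag, hUc ζ _ _ fun j => (hag j).symm⟩
  obtain ⟨α, hα, h⟩ := exists_forall_levTuple_target hκ hs.subset hs.stationary hs.coherent
    hs.hits hs.guesses hθ (H := ext H) (Order.IsSuccLimit.succ_lt hlim hε) (U := U') (by
      intro i hi j hj hag
      rw [hext H i hi, hext H j hj] at hag
      by_contra hij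
      have hne : e ⟨i, hi⟩ ≠ e ⟨j, hj⟩ := fun h => hij (Subtype.ext_iff.1 (e.injective h))
      exact hd2 (_, _) hne (hag _ (Order.lt_succ_iff.2 (hdε _)))) (by
      intro ζ hζ τ hτ
      obtain ⟨ζ', h1, h2, σ', h3, h4, ζ'', h5, h6⟩ := hU ζ hζ (fun j => τ (e.symm j).1) fun j => by
        rw [← hexts H j]
        exact hτ _ (e.symm j).2
      refine ⟨ζ', h1, h2, ext σ', fun i hi => ?_,
        fun i hi => ?_, ζ'', h5, (hnorm _ _).2 ?_⟩
      · rw [hext H i hi, hext σ' i hi]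
        exact h3 _
      · rw [hext σ' i hi]
        have := h4 (e ⟨i, hi⟩)
        rwa [e.symm_apply_apply] at this
      · rwa [funext (hexts σ')])
  refine ⟨α, hα, fun σ hσ => ?_⟩
  obtain ⟨ζ, h1, h2⟩ := h (ext σ) fun i hi => by
    rw [hext H i hi, hext σ i hi]
    exact hσ _
  rw [hnorm, funext (hexts σ)] at h2
  exact ⟨ζ, h1, h2⟩

/-- Different indices give different trees. -/
theorem TreeSetting.indexedTree_injOn : InjOn (indexedTree κ C g) {H | H ⊆ Iio κ.ord} := by
  have hκ := hs.inaccessible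
  have hlim := Cardinal.isSuccLimit_ord hκ.aleph0_lt.le
  intro H hH H' hH' heq
  by_contra hne
  have hag : ¬ AgreeBelow κ.ord H H' := fun h => hne (by
    have := h.inter_eq
    rwa [inter_eq_left.2 hH, inter_eq_left.2 hH'] at this)
  have hlev : ∀ ζ < κ.ord, ∀ t, Lev C g ζ H t ↔ Lev C g ζ H' t := fun ζ hζ t => by
    rw [← ofSet_mem_indexedTree hζ, ← ofSet_mem_indexedTree hζ, heq]
  -- Seal the pairs of distinct nodes, a dense target by splitting: on some level no node of one
  -- tree equals a node of the other. If the trees were equal, the pair `(t, t)` would refute this.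
  obtain ⟨α, hα, h⟩ := hs.exists_forall_target (ι := ULift.{u + 1} Bool)
    (H := fun b => cond b.down H H')
    (U := fun ζ => {σ | ¬ AgreeBelow ζ (σ ⟨true⟩) (σ ⟨false⟩)})
    ((Cardinal.lt_aleph0_of_finite _).trans_le hκ.aleph0_le_lift)
    (by
      rintro ⟨_ | _⟩ ⟨_ | _⟩ h
      · rfl
      · exact absurd h.symm hag
      · exact absurd h hag
      · rfl)
    (fun ζ σ σ' hσ h h' => h (((hσ _).trans h').trans (hσ _).symm))
    (fun ζ hζ σ hσ => by
      refine ⟨Order.succ ζ, hlim.succ_lt hζ, Order.le_succ ζ,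
        fun b => cond b.down (insert ζ (σ b)) (σ b \ {ζ}), fun b => ?_, fun b => ?_,
        Order.succ ζ, le_rfl, fun h => ?_⟩
      · refine ((hσ b).congr (.refl _ _) fun ξ hξ => ?_).succ
        obtain ⟨_ | _⟩ := b <;> simp [hξ.ne]
      · intro ξ hξ
        obtain ⟨_ | _⟩ := b <;> simp [hξ.ne]
      · have := h ζ (Order.lt_succ ζ)
        simp at this)
  obtain ⟨t, ht, -⟩ := exists_lev_extension hs.coherent hα (zero_le)
    (lev_zero (C := C) (g := g) H ∅)
  obtain ⟨ζ, -, hζ⟩ := h (fun _ => t) (by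
    rintro ⟨_ | _⟩
    · exact (hlev α hα t).1 ht
    · exact ht)
  exact hζ (.refl _ _)

end Family

/-! ### Products of the trees -/

section ProductFamily

variable {κ : Cardinal.{u}} {C : Ordinal.{u} → Set Ordinal.{u}} {g : GuessSeq.{u}}
  {ι : Type (u + 1)} {H : ι → Set Ordinal.{u}}

variable (κ C g H) in
/-- The product of the trees with indices `H i`. -/
abbrev IndexedProduct : Type (u + 1) := ProductTree κ fun i => indexedTree κ C g (H i)

/-- The set coding the `i`th coordinate. -/
def nodeSet (x : IndexedProduct κ C g H) (i : ι) : Set Ordinal.{u} := (x.1 i).1.supp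

variable [Nonempty ι]

/-- The common height of the coordinates. -/
noncomputable def nodeHeight (x : IndexedProduct κ C g H) : Ordinal.{u} :=
  (x.1 (Classical.arbitrary ι)).1.len

variable (hκ : κ.IsInaccessible) (hC : IsCoherentClubSeq κ C)
include hκ hC

theorem mem_treeLevel_indexedTree {G : Set Ordinal.{u}} {x : indexedTree κ C g G}
    {α : Ordinal.{u}} : x ∈ treeLevel (indexedTree κ C g G) α ↔ x.1.len = α :=
  (indexedTree_isStreamlined hκ hC).isHeight.mem_treeLevel_iff

theorem len_eq_nodeHeight (x : IndexedProduct κ C g H) (i : ι) : (x.1 i).1.len = nodeHeight x := by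
  obtain ⟨α, -, h⟩ := x.2
  rw [nodeHeight, (mem_treeLevel_indexedTree hκ hC).1 (h i),
    (mem_treeLevel_indexedTree hκ hC).1 (h _)]

theorem lev_nodeSet (x : IndexedProduct κ C g H) (i : ι) :
    Lev C g (nodeHeight x) (H i) (nodeSet x i) := by
  rw [← len_eq_nodeHeight hκ hC x i]
  exact (x.1 i).2.2.2

theorem indexedProduct_ext {x y : IndexedProduct κ C g H} (hh : nodeHeight x = nodeHeight y)
    (h : ∀ i, AgreeBelow (nodeHeight x) (nodeSet x i) (nodeSet y i)) : x = y := by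
  refine Subtype.ext (funext fun i => Subtype.ext ?_)
  refine (x.1 i).2.2.1.eq_of (y.1 i).2.2.1 ?_ ?_
  · rw [len_eq_nodeHeight hκ hC, len_eq_nodeHeight hκ hC, hh]
  · rw [len_eq_nodeHeight hκ hC]
    exact h i

theorem indexedProduct_le_iff {x y : IndexedProduct κ C g H} : x ≤ y ↔
    nodeHeight x ≤ nodeHeight y ∧
      ∀ i, AgreeBelow (nodeHeight x) (nodeSet x i) (nodeSet y i) := by
  constructor
  · rintro (rfl | h)
    · exact ⟨le_rfl, fun i => .refl _ _⟩
    · refine ⟨(OrdSeq.len_lt_of_lt (h _)).le, fun i => ?_⟩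
      rw [← len_eq_nodeHeight hκ hC x i]
      exact ((le_iff_of_mem_indexedTree (x.1 i).2 (y.1 i).2).1 (h i).le).2
  · rintro ⟨h1, h2⟩
    obtain he | hlt := h1.eq_or_lt
    · exact Or.inl (indexedProduct_ext hκ hC he h2)
    · refine Or.inr fun i => lt_of_le_of_ne
        ((le_iff_of_mem_indexedTree (x.1 i).2 (y.1 i).2).2 ⟨?_, ?_⟩) fun h => hlt.ne ?_
      · rw [len_eq_nodeHeight hκ hC, len_eq_nodeHeight hκ hC]
        exact h1
      · rw [len_eq_nodeHeight hκ hC]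
        exact h2 i
      · rw [← len_eq_nodeHeight hκ hC x i, ← len_eq_nodeHeight hκ hC y i, h]

theorem exists_node {ζ : Ordinal.{u}} (hζ : ζ < κ.ord) {σ : ι → Set Ordinal.{u}}
    (hσ : ∀ i, Lev C g ζ (H i) (σ i)) : ∃ x : IndexedProduct κ C g H, nodeHeight x = ζ ∧
      ∀ i, AgreeBelow ζ (nodeSet x i) (σ i) :=
  ⟨⟨fun i => ⟨_, (ofSet_mem_indexedTree hζ).2 (hσ i)⟩, ζ, hζ, fun _ =>
    (mem_treeLevel_indexedTree hκ hC).2 rfl⟩, rfl, fun i => OrdSeq.supp_ofSet ζ (σ i)⟩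

omit hκ hC in
theorem nodeHeight_lt (x : IndexedProduct κ C g H) : nodeHeight x < κ.ord := (x.1 _).2.1

theorem isHeight_nodeHeight : IsHeight (nodeHeight : IndexedProduct κ C g H → Ordinal.{u}) := by
  refine ⟨fun x y h => OrdSeq.len_lt_of_lt (h _), fun x ξ hξ => ?_, fun x y z hy hz h => ?_⟩
  · obtain ⟨y, h1, h2⟩ := exists_node hκ hC (hξ.trans (nodeHeight_lt x)) fun i =>
      (lev_nodeSet hκ hC x i).mono hξ.le
    refine ⟨y, lt_of_le_of_ne ((indexedProduct_le_iff hκ hC).2 ⟨h1.trans_le hξ.le, fun i => ?_⟩)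
      ?_, h1⟩
    · rw [h1]
      exact h2 i
    · rintro rfl
      exact hξ.ne h1.symm
  · rw [indexedProduct_le_iff hκ hC] at hy hz ⊢
    exact ⟨h, fun i => (hy.2 i).trans ((hz.2 i).symm.mono h)⟩

theorem mk_nodeHeight_le_lt (hι : #ι < Cardinal.lift.{u + 1} κ) {α : Ordinal.{u}}
    (hα : α < κ.ord) :
    #{x : IndexedProduct κ C g H | nodeHeight x ≤ α} < Cardinal.lift.{u + 1} κ := by
  have hlim := Cardinal.isSuccLimit_ord hκ.aleph0_lt.le
  refine lt_of_le_of_lt (Cardinal.mk_le_of_injective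
    (β := Iio (Order.succ α) × Set (ι × Iio α))
    (f := fun x => (⟨nodeHeight x.1, mem_Iio.2 (Order.lt_succ_iff.2 x.2)⟩, {p | p.2.1 ∈ nodeSet x.1 p.1})) ?_)
    (hκ.mk_prod_lt (mk_Iio_lt_of_lt_ord (hlim.succ_lt hα))
      (hκ.mk_set_lt (hκ.mk_prod_lt hι (mk_Iio_lt_of_lt_ord hα))))
  rintro ⟨x, hx⟩ ⟨y, hy⟩ h
  obtain ⟨h1, h2⟩ := Prod.mk_inj.1 h
  refine Subtype.ext (indexedProduct_ext hκ hC (Subtype.ext_iff.1 h1) fun i ξ hξ => ?_)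
  exact Set.ext_iff.1 h2 (i, ⟨ξ, hξ.trans_le hx⟩)

theorem indexedProduct_isKappaTree (hι : #ι < Cardinal.lift.{u + 1} κ) :
    IsKappaTree (IndexedProduct κ C g H) κ := by
  refine (isHeight_nodeHeight hκ hC).isKappaTree nodeHeight_lt (fun α hα => ?_) fun α hα => ?_
  · choose σ h1 h2 using fun i => exists_lev_extension hC hα (zero_le)
      (lev_zero (C := C) (g := g) (H i) ∅)
    obtain ⟨x, h, -⟩ := exists_node hκ hC hα h1
    exact ⟨x, h⟩
  · have h1 : #{x : IndexedProduct κ C g H | nodeHeight x = α} < Cardinal.lift.{u + 1} κ :=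
      (Cardinal.mk_le_mk_of_subset fun x hx => le_of_eq hx).trans_lt
        (mk_nodeHeight_le_lt hκ hC hι hα)
    have h2 := Cardinal.lift_lt.{u + 1, u}.2 h1
    simpa using h2

omit hκ hC in
/-- Sealing: some level of the product consists of nodes strictly above members of a given dense
set. -/
theorem TreeSetting.exists_level_above_dense {S : Set Ordinal.{u}} (hs : TreeSetting κ S C g)
    (hι : #ι < Cardinal.lift.{u + 1} κ) (hH : ∀ i j, AgreeBelow κ.ord (H i) (H j) → i = j)
    {Δ : Set (IndexedProduct κ C g H)} (hΔ : ∀ x, ∃ y ∈ Δ, x ≤ y) :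
    ∃ α < κ.ord, ∀ x : IndexedProduct κ C g H, nodeHeight x = α →
      ∃ y ∈ Δ, y ≤ x ∧ nodeHeight y < α := by
  have hκ := hs.inaccessible
  have hC := hs.coherent
  obtain ⟨α, hα, h⟩ := hs.exists_forall_target hι hH
    -- A tuple meets the target at `ζ` when its restriction to height `ζ` is a member of `Δ`.
    (U := fun ζ => {σ | ∃ y ∈ Δ, nodeHeight y = ζ ∧ ∀ i, AgreeBelow ζ (nodeSet y i) (σ i)})
    (fun ζ σ σ' hσ ⟨y, h1, h2, h3⟩ => ⟨y, h1, h2, fun i => (h3 i).trans (hσ i)⟩)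
    (fun ζ hζ σ hσ => by
      obtain ⟨x, rfl, h2⟩ := exists_node hκ hC hζ hσ
      obtain ⟨y, h3, h4⟩ := hΔ x
      rw [indexedProduct_le_iff hκ hC] at h4
      exact ⟨nodeHeight y, nodeHeight_lt y, h4.1, nodeSet y, lev_nodeSet hκ hC y,
        fun i => (h4.2 i).symm.trans (h2 i), nodeHeight y, le_rfl, y, h3, rfl,
        fun i => .refl _ _⟩)
  refine ⟨α, hα, ?_⟩
  rintro x rfl
  obtain ⟨ζ, hζ, y, h1, rfl, h3⟩ := h (nodeSet x) (lev_nodeSet hκ hC x)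
  exact ⟨y, h1, (indexedProduct_le_iff hκ hC).2 ⟨hζ.le, h3⟩, hζ⟩

omit hκ hC in
theorem TreeSetting.indexedProduct_isSouslinTree {S : Set Ordinal.{u}} (hs : TreeSetting κ S C g)
    (hι : #ι < Cardinal.lift.{u + 1} κ) (hH : ∀ i j, AgreeBelow κ.ord (H i) (H j) → i = j) :
    IsSouslinTree (IndexedProduct κ C g H) κ := by
  have hκ := hs.inaccessible
  have hC := hs.coherent
  have hlim := Cardinal.isSuccLimit_ord hκ.aleph0_lt.le
  have hh := isHeight_nodeHeight (g := g) (H := H) hκ hC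
  have hk := indexedProduct_isKappaTree (g := g) (H := H) hκ hC hι
  refine ⟨hk, fun B hB => ?_, fun A hA hcard => ?_⟩
  · obtain ⟨hchain, -, hB2⟩ := hB
    -- Of two different successors of `x` at the same height, a chain contains at most one.
    have hdense : ∀ x : IndexedProduct κ C g H, ∃ y ∈ Bᶜ, x ≤ y := by
      intro x
      have hx := nodeHeight_lt x
      have key : ∀ r : Set Ordinal.{u} → Set Ordinal.{u},
          (∀ X, AgreeBelow (nodeHeight x) (r X) X) →
          ∃ y : IndexedProduct κ C g H, nodeHeight y = Order.succ (nodeHeight x) ∧ x ≤ y ∧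
            ∀ i, AgreeBelow (Order.succ (nodeHeight x)) (nodeSet y i) (r (nodeSet x i)) := by
        intro r hr
        obtain ⟨y, h1, h2⟩ := exists_node hκ hC (hlim.succ_lt hx) fun i =>
          ((lev_nodeSet hκ hC x i).congr (.refl _ _) (hr (nodeSet x i)).symm).succ
        refine ⟨y, h1, (indexedProduct_le_iff hκ hC).2 ⟨h1 ▸ Order.le_succ _, fun i => ?_⟩, h2⟩
        exact (hr _).symm.trans ((h2 i).symm.mono (Order.le_succ _))
      obtain ⟨y, hy1, hy2, hy3⟩ := key (fun X => insert (nodeHeight x) X) fun X ξ hξ => by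
        simp [hξ.ne]
      obtain ⟨z, hz1, hz2, hz3⟩ := key (fun X => X \ {nodeHeight x}) fun X ξ hξ => by
        simp [hξ.ne]
      by_cases hyB : y ∈ B
      · refine ⟨z, fun hzB => ?_, hz2⟩
        have hyz : y = z := by
          obtain h | h := hchain.total hyB hzB
          · exact hh.eq_of_le h le_rfl (hy1.trans hz1.symm)
          · exact hh.eq_of_le le_rfl h (hy1.trans hz1.symm)
        have i := Classical.arbitrary ι
        have h1 := (hy3 i _ (Order.lt_succ _)).2 (mem_insert _ _)
        rw [hyz] at h1
        exact ((hz3 i _ (Order.lt_succ _)).1 h1).2 rfl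
      · exact ⟨y, hyB, hy2⟩
    obtain ⟨α, hα, h⟩ := hs.exists_level_above_dense hι hH hdense
    obtain ⟨x, hxB, hx⟩ := hB2 α hα
    rw [hh.mem_treeLevel_iff] at hx
    obtain ⟨y, hy, hyx, hyα⟩ := h x hx
    -- The branch node `x` lies above a node `y` outside `B`, yet its predecessor at that height is
    -- in `B`.
    obtain ⟨b, hb, hby⟩ := hB2 (nodeHeight y) (nodeHeight_lt y)
    rw [hh.mem_treeLevel_iff] at hby
    have hbx : b ≤ x := by
      refine (hchain.total hb hxB).resolve_right fun h' => ?_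
      have := hh.strictMono.monotone h'
      rw [hx, hby] at this
      exact this.not_gt hyα
    exact hy (hh.eq_of_le hbx hyx hby ▸ hb)
  · obtain ⟨α, hα, h⟩ := hs.exists_level_above_dense hι hH
      -- These nodes decide `A`: either they are above a member, or no extension is. If level `α` is
      -- above them, no member of `A` has height greater than `α`, so `A` is small.
      (Δ := {x | (∃ a ∈ A, a ≤ x) ∨ ∀ y, x ≤ y → ∀ a ∈ A, ¬ a ≤ y}) (fun x => by
        by_cases hx : ∀ y, x ≤ y → ∀ a ∈ A, ¬ a ≤ y
        · exact ⟨x, Or.inr hx, le_rfl⟩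
        · push Not at hx
          obtain ⟨y, hxy, a, ha, hay⟩ := hx
          exact ⟨y, Or.inl ⟨a, ha, hay⟩, hxy⟩)
    have hsub : A ⊆ {x | nodeHeight x ≤ α} := by
      intro a ha
      by_contra hlt
      rw [mem_ofPred_eq, not_le] at hlt
      obtain ⟨x, hxa, hx⟩ := hh.exists_lt a α hlt
      obtain ⟨d, hd, hdx, hdα⟩ := h x hx
      have hda := hdx.trans hxa.le
      obtain ⟨a', ha', had⟩ | hd := hd
      · have haa : a' = a := by
          by_contra hne
          exact hA ha' ha hne (had.trans hda)
        subst haa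
        exact ((hh.strictMono.monotone had).trans_lt hdα).not_gt hlt
      · exact hd a hda a ha le_rfl
    have hlt := (Cardinal.mk_le_mk_of_subset hsub).trans_lt (mk_nodeHeight_le_lt hκ hC hι hα)
    have h2 := Cardinal.lift_lt.{u + 1, u}.2 hlt
    refine absurd hcard (ne_of_lt ?_)
    simpa using h2

end ProductFamily

/-- The type and the order of the product depend on the family `T`; generalizing `T` lets `subst`
replace it by the indexed trees. -/
theorem TreeSetting.isSouslinTree_of_eq {κ : Cardinal.{u}} {S : Set Ordinal.{u}}
    {C : Ordinal.{u} → Set Ordinal.{u}} {g : GuessSeq.{u}} (hs : TreeSetting κ S C g)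
    {ι : Type (u + 1)} [Nonempty ι] (hι : #ι < Cardinal.lift.{u + 1} κ)
    {H : ι → Set Ordinal.{u}} (hH : ∀ i j, AgreeBelow κ.ord (H i) (H j) → i = j)
    {T : ι → Set OrdSeq.{u}} (hT : T = fun i => indexedTree κ C g (H i)) :
    IsSouslinTree (ProductTree κ fun i => T i) κ := by
  subst hT
  exact hs.indexedProduct_isSouslinTree hι hH

theorem exists_treeSetting {κ : Cardinal.{u}} (hκ : κ.IsInaccessible) {S : Set Ordinal.{u}}
    (hS : S ⊆ uncountableCofBelow κ) (hS' : StationaryIn κ.ord S)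
    (hD : DiamondStarTrees κ S (Iio κ.ord)) (hP : ProxyMinusTwo κ InitSegOf 1 {S}) :
    ∃ C g, TreeSetting κ S C g := by
  obtain ⟨C, hC, hcoh, hhit⟩ := hP
  obtain ⟨g, hg⟩ := exists_guessesTuples hκ hD
  refine ⟨C, g, hκ, hS, hS', hC.isCoherentClubSeq hcoh, fun B hB hBu => ?_, hg⟩
  refine IsStationary.mono (hhit (fun _ => B) (fun _ _ => ⟨hB, fun γ hγ => ?_⟩) S rfl) ?_
  · obtain ⟨ζ, h1, h2, -⟩ := hBu γ hγ
    exact ⟨ζ, h1, h2.le⟩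
  · rintro ⟨α, hακ⟩ ⟨h1, h2⟩
    have hα0 : 0 < α := (isSuccLimit_of_aleph0_lt_cof (hS h1).2).bot_lt
    refine ⟨h1, (isLimPt_iff _ _).2 ⟨?_, hα0⟩⟩
    -- For `θ = 1` only the index `0` occurs, and `0 < α` makes it available.
    have h3 := h2 0 (lt_min hα0 (by simp))
    rwa [inter_eq_left.2 fun γ hγ => (hC α hακ).1 hγ.1.1]

theorem mainTheorem5 (κ : Cardinal.{u}) (hκ : κ.IsInaccessible)
    (S : Set Ordinal.{u}) (hS : S ⊆ uncountableCofBelow κ) (hS' : StationaryIn κ.ord S)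
    (hD : DiamondStarTrees κ S (Iio κ.ord))
    (hP : ProxyMinusTwo κ InitSegOf 1 {S}) :
    ∃ 𝒯 : Set (Set OrdSeq.{u}), #𝒯 = Cardinal.lift.{u + 1} (2 ^ κ) ∧
      (∀ T ∈ 𝒯, IsStreamlined κ T ∧ IsBinary T ∧ IsNormalTree T κ ∧ IsSplittingTree T ∧
        IsFullTree T κ) ∧
      ∀ 𝒯' : Set (Set OrdSeq.{u}), 𝒯' ⊆ 𝒯 → #𝒯' < Cardinal.lift.{u + 1} κ →
        ∀ [Nonempty 𝒯'], IsSouslinTree (ProductTree κ (fun T : 𝒯' => T.1)) κ := by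
  obtain ⟨C, g, hs⟩ := exists_treeSetting hκ hS hS' hD hP
  have hC := hs.coherent
  refine ⟨indexedTree κ C g '' {H | H ⊆ Iio κ.ord}, ?_, ?_, fun 𝒯' hsub hcard _ => ?_⟩
  · rw [Cardinal.mk_image_eq_of_injOn _ _ hs.indexedTree_injOn]
    change #(𝒫 (Iio κ.ord)) = _
    rw [Cardinal.mk_powerset, Cardinal.mk_Iio_ordinal, Cardinal.card_ord, Cardinal.lift_two_power]
  · rintro _ ⟨H, -, rfl⟩
    exact ⟨indexedTree_isStreamlined hκ hC, indexedTree_isBinary,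
      indexedTree_isNormalTree hκ hC, indexedTree_isSplittingTree hκ hC,
      indexedTree_isFullTree hκ hC⟩
  -- Different trees have different indices because the index determines the tree; injectivity of
  -- `indexedTree` is needed only for the cardinality of the family.
  · choose H hH1 hH2 using fun T : 𝒯' => hsub T.2
    refine hs.isSouslinTree_of_eq hcard (H := H) (fun T T' h => Subtype.ext ?_)
      (funext fun T => (hH2 T).symm)
    have := h.inter_eq
    rw [inter_eq_left.2 (hH1 T), inter_eq_left.2 (hH1 T')] at this
    rw [← hH2 T, ← hH2 T', this]
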